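/- Let $a,b,c,\nu\in\mathbb C$, where $\nu$ is not a negative integer and $a\nu^2+c+(b-a)\nu\neq 0$. Let $J_\nu$ be the Bessel function of the first kind, put $$N_\nu(z)=az^2J_\nu''(z)+bzJ_\nu'(z)+cJ_\nu(z),$$ $$p=2a(a\nu^2+c)+(a^2-b^2),\quad q=(a\nu^2+c)^2-\nu^2(a-b)^2,\quad r=a\nu^2(3a-b)+c(a+b).$$ Then $z^{-\nu}N_\nu(z)$ (principal branches, $z\in\mathbb C\setminus(-\infty,0]$) extends to an even entire function. It has infinitely many zeros, which can be listed with multiplicity as $\pm t_1,\pm t_2,\dots$, and none of them is $0$. For every such listing put $\zeta_k=t_k^2$ and $\tau_n=\sum_{k=1}^\infty\zeta_k^{-n}$ for $n\ge1$. These series converge absolutely, and $$\tau_1=\frac{2\nu p+q+2r}{4q(\nu+1)}\qquad\text{if } q\neq0,$$ $$4q(\nu+2)\tau_2=4q\tau_1^2+4\nu p\,\tau_1-p-4a^2\nu+2a(a+b),$$ $$4q(\nu+3)\tau_3=4p(\nu+1)\tau_2-4a^2(\nu-1)\tau_1+a^2+8q\tau_1\tau_2-4p\tau_1^2,$$ and,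 for every $k\ge3$, $$q(k+\nu+1)\tau_{k+1}=p(k+\nu-1)\tau_k-a^2(k+\nu-3)\tau_{k-1}+q\sum_{m=1}^{k}\tau_m\tau_{k-m+1}-p\sum_{m=1}^{k-1}\tau_m\tau_{k-m}+a^2\sum_{m=1}^{k-2}\tau_m\tau_{k-m-1}.$$ In the special case $a=b=0$, $c=1$ one has $p=0$, $q=1$, $r=0$ and $N_\nu=J_\nu$, and the sums, then denoted $\sigma_n$, satisfy $$\sigma_1=\frac1{4(\nu+1)},\qquad \sigma_n=\frac1{\nu+n}\sum_{k=1}^{n-1}\sigma_k\sigma_{n-k}\quad(n\ge2).$$ -/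

import Mathlib

noncomputable section

/-- The Bessel function of the first kind
`J_ν(z) = ∑ (-1)^n (z/2)^(2n+ν) / (n! Γ(ν+n+1))`, with the principal branch of the power
(it is used on the slit plane only). -/
def besselJ (ν z : ℂ) : ℂ :=
  ∑' n : ℕ, (-1 : ℂ) ^ n * (z / 2) ^ (2 * (n : ℂ) + ν) /
    ((n.factorial : ℂ) * Complex.Gamma (ν + n + 1))

/-- `N_ν(z) = a z² J_ν''(z) + b z J_ν'(z) + c J_ν(z)`. -/
def besselN (a b c ν z : ℂ) : ℂ :=
  a * z ^ 2 * iteratedDeriv 2 (besselJ ν) z + b * z * deriv (besselJ ν) z + c * besselJ ν z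

/-- `F` is the entire function `z^(-ν) f(z)`: it is entire, and it is given by that expression on
the plane cut along the negative real axis, where the principal branches are analytic. By the
identity theorem there is at most one such `F`. -/
def IsEntireQuotient (ν : ℂ) (f F : ℂ → ℂ) : Prop :=
  Differentiable ℂ F ∧ ∀ z ∈ Complex.slitPlane, F z = z ^ (-ν) * f z

/-- The list `t 0, -t 0, t 1, -t 1, …` consists of all the zeros of `F`, each occurring as
many times as its multiplicity. -/
def IsZeroPairSequence (F : ℂ → ℂ) (t : ℕ → ℂ) : Prop :=
  ∀ w : ℂ, {k : ℕ | t k = w}.encard + {k : ℕ | -t k = w}.encard = analyticOrderAt F w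

/-- The Rayleigh sum `τ_n = ∑ ζ_k^(-n)` with `ζ_k = t_k²`. -/
def rayleighSum (t : ℕ → ℂ) (n : ℕ) : ℂ := ∑' k : ℕ, ((t k ^ 2) ^ n)⁻¹

/-- `p = 2a(aν² + c) + (a² - b²)`. -/
def coeffP (a b c ν : ℂ) : ℂ := 2 * a * (a * ν ^ 2 + c) + (a ^ 2 - b ^ 2)

/-- `q = (aν² + c)² - ν²(a - b)²`. -/
def coeffQ (a b c ν : ℂ) : ℂ := (a * ν ^ 2 + c) ^ 2 - ν ^ 2 * (a - b) ^ 2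

/-- `r = aν²(3a - b) + c(a + b)`. -/
def coeffR (a b c ν : ℂ) : ℂ := a * ν ^ 2 * (3 * a - b) + c * (a + b)

end

/-!
`z ^ (-ν) * N_ν z` is `G (z ^ 2)` for an entire function `G` of exponential order at most `1 / 2`,
so Hadamard factorization gives `G w = G 0 * ∏ (1 - w / ζ_k)` and the power sums `τ_n` are the
Taylor coefficients of `S = -w * G' / G`; if the zeros were finite in number, `G` would be a
polynomial.

With `∂ = 2 w d/dw + ν`, which is the operator `z d/dz` seen through `z ^ ν * G (z ^ 2)`, Bessel's
equation makes `G` and `∂ G` linear combinations of the Bessel function and its derivative, with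
coefficients linear in `w` and determinant `q - p w + a² w²`. Eliminating the Bessel function gives
a second order linear equation for `G`, hence a Riccati equation for `S`; its coefficients are the
recurrences.
-/

open Filter Topology

theorem one_add_rpow_add_one_le {ρ x : ℝ} (hρ : 0 ≤ ρ) (hx : 0 ≤ x) :
    1 + (x + 1) ^ ρ ≤ (1 + 2 ^ ρ) * (1 + x ^ ρ) := by
  have hpow : (x + 1) ^ ρ ≤ 2 ^ ρ * (1 + x ^ ρ) := by
    rcases le_total x 1 with h | h
    · calc (x + 1) ^ ρ ≤ 2 ^ ρ := by gcongr; linarith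
        _ ≤ 2 ^ ρ * (1 + x ^ ρ) :=
          le_mul_of_one_le_right (by positivity) (le_add_of_nonneg_right (by positivity))
    · calc (x + 1) ^ ρ ≤ (2 * x) ^ ρ := by gcongr; linarith
        _ = 2 ^ ρ * x ^ ρ := Real.mul_rpow (by norm_num) hx
        _ ≤ 2 ^ ρ * (1 + x ^ ρ) := by gcongr; linarith
  have : 0 ≤ x ^ ρ := by positivity
  linarith

/-- `f` is of order at most `ρ` and, if the order is exactly `ρ`, of finite type. The summand `1`
absorbs constant factors. -/
def HasExpGrowth (ρ : ℝ) (f : ℂ → ℂ) : Prop :=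
  ∃ K : ℝ, 0 ≤ K ∧ ∀ w, ‖f w‖ ≤ Real.exp (K * (1 + ‖w‖ ^ ρ))

namespace HasExpGrowth

variable {ρ : ℝ} {f g : ℂ → ℂ}

theorem const (ρ : ℝ) (c : ℂ) : HasExpGrowth ρ fun _ => c := by
  refine ⟨‖c‖, norm_nonneg c, fun w => ?_⟩
  calc ‖c‖ ≤ ‖c‖ * (1 + ‖w‖ ^ ρ) :=
        le_mul_of_one_le_right (norm_nonneg c) (le_add_of_nonneg_right (by positivity))
    _ ≤ Real.exp (‖c‖ * (1 + ‖w‖ ^ ρ)) := by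
        linarith [Real.add_one_le_exp (‖c‖ * (1 + ‖w‖ ^ ρ))]

theorem id (hρ : 0 < ρ) : HasExpGrowth ρ fun w => w := by
  refine ⟨ρ⁻¹, by positivity, fun w => ?_⟩
  calc ‖w‖ = (‖w‖ ^ ρ) ^ ρ⁻¹ := (Real.rpow_rpow_inv (norm_nonneg w) hρ.ne').symm
    _ ≤ Real.exp (1 + ‖w‖ ^ ρ) ^ ρ⁻¹ := by
        gcongr
        linarith [Real.add_one_le_exp (1 + ‖w‖ ^ ρ)]
    _ = Real.exp (ρ⁻¹ * (1 + ‖w‖ ^ ρ)) := by rw [← Real.exp_mul, mul_comm]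

theorem mul (hf : HasExpGrowth ρ f) (hg : HasExpGrowth ρ g) :
    HasExpGrowth ρ fun w => f w * g w := by
  obtain ⟨K, hK, hf⟩ := hf
  obtain ⟨L, hL, hg⟩ := hg
  refine ⟨K + L, by positivity, fun w => ?_⟩
  rw [norm_mul, add_mul, Real.exp_add]
  gcongr
  exacts [hf w, hg w]

theorem add (hf : HasExpGrowth ρ f) (hg : HasExpGrowth ρ g) :
    HasExpGrowth ρ fun w => f w + g w := by
  obtain ⟨K, hK, hf⟩ := hf
  obtain ⟨L, -, hg⟩ := hg
  refine ⟨max K L + 1, by positivity, fun w => ?_⟩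
  set y := 1 + ‖w‖ ^ ρ
  have hy : 1 ≤ y := le_add_of_nonneg_right (by positivity)
  calc ‖f w + g w‖ ≤ Real.exp (K * y) + Real.exp (L * y) := norm_add_le_of_le (hf w) (hg w)
    _ ≤ 2 * Real.exp (max K L * y) := by
        rw [two_mul]
        gcongr
        exacts [le_max_left K L, le_max_right K L]
    _ ≤ Real.exp y * Real.exp (max K L * y) := by
        gcongr
        linarith [Real.add_one_le_exp y]
    _ = Real.exp ((max K L + 1) * y) := by rw [← Real.exp_add]; ring_nf

theorem deriv (hρ : 0 ≤ ρ) (hd : Differentiable ℂ f) (hf : HasExpGrowth ρ f) :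
    HasExpGrowth ρ (deriv f) := by
  obtain ⟨K, hK, hf⟩ := hf
  refine ⟨K * (1 + 2 ^ ρ), by positivity, fun w => ?_⟩
  have hsphere : ∀ z ∈ Metric.sphere w 1, ‖f z‖ ≤ Real.exp (K * (1 + (‖w‖ + 1) ^ ρ)) := by
    intro z hz
    have hzw : ‖z‖ ≤ ‖w‖ + 1 := norm_le_norm_add_const_of_dist_le (Metric.mem_sphere.1 hz).le
    exact (hf z).trans (by gcongr)
  have hcauchy := Complex.norm_deriv_le_of_forall_mem_sphere_norm_le one_pos hd.diffContOnCl hsphere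
  rw [div_one] at hcauchy
  refine hcauchy.trans ?_
  rw [mul_assoc]
  gcongr
  exact one_add_rpow_add_one_le hρ (norm_nonneg w)

end HasExpGrowth

/-- The family `ζ` lists all the zeros of `G`, each as often as its multiplicity. -/
def ListsZeros {ι : Type*} (G : ℂ → ℂ) (ζ : ι → ℂ) : Prop :=
  ∀ w : ℂ, {i | ζ i = w}.encard = analyticOrderAt G w

/-- `g` is what remains of the entire function `G` after division by the factors `1 - w / ζ i`
with `i ∈ s`, where `ζ` lists the zeros of `G`. -/
structure IsCofactor {ι : Type*} (G : ℂ → ℂ) (ζ : ι → ℂ) (s : Finset ι) (g : ℂ → ℂ) : Prop where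
  differentiable : Differentiable ℂ g
  eq_prod_mul : ∀ w, G w = (∏ i ∈ s, (1 - (ζ i)⁻¹ * w)) * g w
  encard_eq : ∀ w, {i | i ∉ s ∧ ζ i = w}.encard = analyticOrderAt g w

theorem analyticOrderAt_one_sub_inv_mul {x : ℂ} (hx : x ≠ 0) (w : ℂ) [Decidable (x = w)] :
    analyticOrderAt (fun w => 1 - x⁻¹ * w) w = if x = w then 1 else 0 := by
  split_ifs with h
  · subst h
    have hderiv : HasDerivAt (fun w => 1 - x⁻¹ * w) (-x⁻¹) x := by
      simpa using ((hasDerivAt_id x).const_mul x⁻¹).const_sub 1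
    have hanalytic : AnalyticAt ℂ (fun w => 1 - x⁻¹ * w) x := by fun_prop
    simpa [hx] using
      hanalytic.analyticOrderAt_sub_eq_one_of_deriv_ne_zero (by simpa [hderiv.deriv] using hx)
  · refine analyticOrderAt_eq_zero.2 (Or.inr fun hw => h ?_)
    field_simp at hw
    rw [mul_zero] at hw
    exact sub_eq_zero.1 hw

theorem exists_eq_one_sub_inv_mul_mul {g : ℂ → ℂ} (hg : Differentiable ℂ g) {x : ℂ} (hx : x ≠ 0)
    (hgx : g x = 0) :
    ∃ h : ℂ → ℂ, Differentiable ℂ h ∧ g = (fun w => 1 - x⁻¹ * w) * h := by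
  refine ⟨fun w => -x * dslope g x w, Differentiable.const_mul ?_ _, funext fun w => ?_⟩
  · rw [← differentiableOn_univ, Complex.differentiableOn_dslope univ_mem]
    exact hg.differentiableOn
  · have hslope := sub_smul_dslope_of_zero hgx w
    rw [smul_eq_mul] at hslope
    rw [Pi.mul_apply, ← hslope]
    field_simp
    ring

theorem encard_notMem_eq_add {ι α : Type*} [DecidableEq ι] [DecidableEq α] {s : Finset ι} {j : ι}
    (hj : j ∉ s) (ζ : ι → α) (w : α) :
    {i | i ∉ s ∧ ζ i = w}.encard
      = (if ζ j = w then 1 else 0) + {i | i ∉ insert j s ∧ ζ i = w}.encard := by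
  split_ifs with hw
  · have hset : {i | i ∉ s ∧ ζ i = w} = insert j {i | i ∉ insert j s ∧ ζ i = w} := by
      ext i
      by_cases hij : i = j
      · subst hij; simp [hj, hw]
      · simp [hij]
    rw [hset, Set.encard_insert_of_notMem (by simp), add_comm]
  · rw [zero_add]
    congr 1
    ext i
    by_cases hij : i = j
    · subst hij; simp [hw]
    · simp [hij]

section Zeros

variable {ι : Type*} {G : ℂ → ℂ} {ζ : ι → ℂ} {s : Finset ι} {g : ℂ → ℂ} {ρ : ℝ}

theorem ListsZeros.apply_eq_zero (hG : ListsZeros G ζ) (i : ι) : G (ζ i) = 0 := by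
  by_contra h
  have horder := analyticOrderAt_eq_zero.2 (Or.inr h)
  rw [← hG, Set.encard_eq_zero] at horder
  exact (Set.ext_iff.1 horder i).1 rfl

theorem ListsZeros.ne_zero (hG : ListsZeros G ζ) (h0 : G 0 ≠ 0) (i : ι) : ζ i ≠ 0 :=
  fun hi => h0 (hi ▸ hG.apply_eq_zero i)

theorem ListsZeros.exists_pos_le_norm (hG : ListsZeros G ζ) (hc : ContinuousAt G 0)
    (h0 : G 0 ≠ 0) : ∃ δ > 0, ∀ i, δ ≤ ‖ζ i‖ := by
  obtain ⟨δ, hδ, hne⟩ := Metric.eventually_nhds_iff.1 (hc.eventually_ne h0)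
  refine ⟨δ, hδ, fun i => ?_⟩
  by_contra! hlt
  exact hne (by simpa using hlt) (hG.apply_eq_zero i)

theorem IsCofactor.apply_ne_zero (hg : IsCofactor G ζ s g) {w : ℂ} (hw : ∀ i, ζ i = w → i ∈ s) :
    g w ≠ 0 := by
  have hempty : {i | i ∉ s ∧ ζ i = w} = ∅ :=
    Set.eq_empty_of_forall_notMem fun i hi => hi.1 (hw i hi.2)
  have horder := hg.encard_eq w
  rw [hempty, Set.encard_empty, eq_comm, analyticOrderAt_eq_zero] at horder
  exact horder.resolve_left (not_not.2 (hg.differentiable.analyticAt w))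

theorem IsCofactor.apply_eq_zero (hg : IsCofactor G ζ s g) {j : ι} (hj : j ∉ s) :
    g (ζ j) = 0 := by
  by_contra h
  have horder := analyticOrderAt_eq_zero.2 (Or.inr h)
  rw [← hg.encard_eq, Set.encard_eq_zero] at horder
  exact (Set.ext_iff.1 horder j).1 ⟨hj, rfl⟩

theorem IsCofactor.apply_zero (hg : IsCofactor G ζ s g) : g 0 = G 0 := by
  simp [hg.eq_prod_mul 0]

theorem IsCofactor.exists_insert [DecidableEq ι] (hg : IsCofactor G ζ s g) {j : ι} (hj : j ∉ s)
    (hζ : ζ j ≠ 0) : ∃ h, IsCofactor G ζ (insert j s) h := by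
  classical
  obtain ⟨h, hd, hgh⟩ :=
    exists_eq_one_sub_inv_mul_mul hg.differentiable hζ (hg.apply_eq_zero hj)
  refine ⟨h, hd, fun w => ?_, fun w => ?_⟩
  · rw [Finset.prod_insert hj, hg.eq_prod_mul w, congrFun hgh w, Pi.mul_apply]
    ring
  · have horder := hg.encard_eq w
    rw [hgh, analyticOrderAt_mul (by fun_prop) (hd.analyticAt w),
      analyticOrderAt_one_sub_inv_mul hζ, encard_notMem_eq_add hj] at horder
    refine ENat.add_right_injective_of_ne_top ?_ horder
    split_ifs
    exacts [ENat.one_ne_top, ENat.zero_ne_top]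

theorem ListsZeros.exists_isCofactor (hG : ListsZeros G ζ) (hd : Differentiable ℂ G)
    (h0 : G 0 ≠ 0) (s : Finset ι) : ∃ g, IsCofactor G ζ s g := by
  classical
  induction s using Finset.induction_on with
  | empty => exact ⟨G, hd, by simp, by simpa [ListsZeros] using hG⟩
  | insert j s hj ih =>
    obtain ⟨g, hg⟩ := ih
    exact hg.exists_insert hj (hG.ne_zero h0 j)

theorem pow_card_le_norm_prod_one_sub {R c : ℝ} (hc : 0 ≤ c)
    (hs : ∀ i ∈ s, ζ i ≠ 0 ∧ ‖ζ i‖ ≤ R) {z : ℂ} (hz : ‖z‖ = (c + 1) * R) :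
    c ^ s.card ≤ ‖∏ i ∈ s, (1 - (ζ i)⁻¹ * z)‖ := by
  rw [norm_prod, ← Finset.prod_const]
  refine Finset.prod_le_prod (fun _ _ => hc) fun i hi => ?_
  obtain ⟨hi0, hiR⟩ := hs i hi
  have hnorm : c + 1 ≤ ‖(ζ i)⁻¹ * z‖ := by
    rw [norm_mul, norm_inv, hz, inv_mul_eq_div, le_div_iff₀ (norm_pos_iff.2 hi0)]
    gcongr
  have htriangle := norm_sub_norm_le ((ζ i)⁻¹ * z) 1
  rw [norm_sub_rev, norm_one] at htriangle
  linarith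

theorem IsCofactor.norm_mul_pow_le (hg : IsCofactor G ζ s g) {M R c : ℝ} (hR : 0 < R) (hc : 0 ≤ c)
    (hs : ∀ i ∈ s, ζ i ≠ 0 ∧ ‖ζ i‖ ≤ R) (hM : ∀ z, ‖z‖ = (c + 1) * R → ‖G z‖ ≤ M)
    {w : ℂ} (hw : ‖w‖ ≤ (c + 1) * R) :
    ‖g w‖ * c ^ s.card ≤ M := by
  have hpos : 0 < (c + 1) * R := by positivity
  have hmax := Complex.norm_le_of_forall_mem_frontier_norm_le (U := Metric.ball 0 ((c + 1) * R))
    (f := fun w => g w * (c : ℂ) ^ s.card) (C := M) (z := w) Metric.isBounded_ball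
    (hg.differentiable.mul_const _).diffContOnCl (fun z hz => ?_) ?_
  · simpa [abs_of_nonneg hc] using hmax
  · rw [frontier_ball _ hpos.ne', mem_sphere_zero_iff_norm] at hz
    calc ‖g z * (c : ℂ) ^ s.card‖ = c ^ s.card * ‖g z‖ := by
          simp [abs_of_nonneg hc, mul_comm]
      _ ≤ ‖∏ i ∈ s, (1 - (ζ i)⁻¹ * z)‖ * ‖g z‖ := by
          gcongr
          exact pow_card_le_norm_prod_one_sub hc hs hz
      _ = ‖G z‖ := by rw [hg.eq_prod_mul z, norm_mul]
      _ ≤ M := hM z hz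
  · simpa [closure_ball _ hpos.ne'] using hw

theorem ListsZeros.exists_card_le (hG : ListsZeros G ζ) (hd : Differentiable ℂ G) (h0 : G 0 ≠ 0)
    (hρ : 0 ≤ ρ) (hgrowth : HasExpGrowth ρ G) :
    ∃ D : ℝ, ∀ R : ℝ, 0 ≤ R → ∀ s : Finset ι, (∀ i ∈ s, ‖ζ i‖ ≤ R) →
      (s.card : ℝ) ≤ D * R ^ ρ := by
  obtain ⟨K, hK, hgrowth⟩ := hgrowth
  obtain ⟨δ, hδ, hle⟩ := hG.exists_pos_le_norm hd.continuous.continuousAt h0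
  set e := Real.exp 1
  set ℓ := |Real.log ‖G 0‖|
  refine ⟨(K + ℓ) / δ ^ ρ + K * (e + 1) ^ ρ, fun R hR s hs => ?_⟩
  obtain rfl | ⟨j, hj⟩ := s.eq_empty_or_nonempty
  · simp only [Finset.card_empty, Nat.cast_zero]
    positivity
  have hδR : δ ≤ R := (hle j).trans (hs j hj)
  obtain ⟨g, hg⟩ := hG.exists_isCofactor hd h0 s
  have hbound : ‖G 0‖ * e ^ s.card ≤ Real.exp (K * (1 + ((e + 1) * R) ^ ρ)) := by
    rw [← hg.apply_zero]
    refine hg.norm_mul_pow_le (hδ.trans_le hδR) (Real.exp_nonneg 1)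
      (fun i hi => ⟨hG.ne_zero h0 i, hs i hi⟩) (fun z hz => hz ▸ hgrowth z) ?_
    simpa using mul_nonneg (add_nonneg (Real.exp_nonneg 1) zero_le_one) hR
  have hlog := Real.log_le_log (by positivity) hbound
  rw [Real.log_mul (norm_ne_zero_iff.2 h0) (by positivity), Real.log_pow, Real.log_exp,
    Real.log_exp, mul_one, Real.mul_rpow (by positivity) hR] at hlog
  calc (s.card : ℝ) ≤ (K + ℓ) * 1 + K * (e + 1) ^ ρ * R ^ ρ := by
        linarith [neg_abs_le (Real.log ‖G 0‖)]
    _ ≤ (K + ℓ) * (R ^ ρ / δ ^ ρ) + K * (e + 1) ^ ρ * R ^ ρ := by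
        gcongr
        rw [one_le_div (by positivity)]
        gcongr
    _ = ((K + ℓ) / δ ^ ρ + K * (e + 1) ^ ρ) * R ^ ρ := by ring

theorem sum_rpow_neg_le_of_card_le {x : ι → ℝ} {D σ : ℝ} (hρ : 0 < ρ) (hσ : 0 < σ)
    (hx : ∀ i, 0 < x i)
    (hD : ∀ R : ℝ, 0 ≤ R → ∀ s : Finset ι, (∀ i ∈ s, x i ≤ R) → (s.card : ℝ) ≤ D * R ^ ρ)
    (s : Finset ι) :
    ∑ i ∈ s, x i ^ (-σ) ≤
      ∑ k ∈ Finset.range s.card, D ^ (σ / ρ) * ((k + 1 : ℕ) : ℝ) ^ (-(σ / ρ)) := by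
  classical
  induction s using Finset.induction_on_max_value x with
  | empty => simp
  | insert j s hj hmax ih =>
    have hcard : ((s.card + 1 : ℕ) : ℝ) ≤ D * x j ^ ρ := by
      rw [← Finset.card_insert_of_notMem hj]
      exact hD _ (hx j).le _ fun i hi =>
        (Finset.mem_insert.1 hi).elim (fun h => h ▸ le_rfl) (hmax i)
    have hxj : 0 < x j ^ ρ := Real.rpow_pos_of_pos (hx j) ρ
    have hDpos : 0 < D := pos_of_mul_pos_left (lt_of_lt_of_le (by positivity) hcard) hxj.le
    have hterm : x j ^ (-σ) ≤ D ^ (σ / ρ) * ((s.card + 1 : ℕ) : ℝ) ^ (-(σ / ρ)) := by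
      have hpow : ((s.card + 1 : ℕ) : ℝ) ^ (σ / ρ) ≤ D ^ (σ / ρ) * x j ^ σ := by
        calc ((s.card + 1 : ℕ) : ℝ) ^ (σ / ρ) ≤ (D * x j ^ ρ) ^ (σ / ρ) := by gcongr
          _ = D ^ (σ / ρ) * x j ^ σ := by
            rw [Real.mul_rpow hDpos.le hxj.le, ← Real.rpow_mul (hx j).le, mul_div_cancel₀ _ hρ.ne']
      have hxσ : 0 < x j ^ σ := Real.rpow_pos_of_pos (hx j) σ
      rw [Real.rpow_neg (hx j).le, Real.rpow_neg (by positivity), ← div_eq_mul_inv,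
        le_div_iff₀ (by positivity), inv_mul_le_iff₀ hxσ]
      linarith
    rw [Finset.sum_insert hj, Finset.card_insert_of_notMem hj, Finset.sum_range_succ, add_comm]
    exact add_le_add ih hterm

theorem summable_rpow_neg_of_card_le {x : ι → ℝ} {D σ : ℝ} (hρ : 0 < ρ) (hσ : ρ < σ)
    (hx : ∀ i, 0 < x i)
    (hD : ∀ R : ℝ, 0 ≤ R → ∀ s : Finset ι, (∀ i ∈ s, x i ≤ R) → (s.card : ℝ) ≤ D * R ^ ρ) :
    Summable fun i => x i ^ (-σ) := by
  have hD0 : 0 ≤ D := by simpa using hD 1 zero_le_one ∅ (by simp)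
  have hseries : Summable fun k : ℕ => D ^ (σ / ρ) * ((k + 1 : ℕ) : ℝ) ^ (-(σ / ρ)) :=
    ((summable_nat_add_iff 1).2 <|
      Real.summable_nat_rpow.2 (neg_lt_neg ((one_lt_div hρ).2 hσ))).mul_left _
  exact summable_of_sum_le (fun i => (Real.rpow_pos_of_pos (hx i) _).le) fun s =>
    (sum_rpow_neg_le_of_card_le hρ (hρ.trans hσ) hx hD s).trans
      (hseries.sum_le_tsum _ fun k _ => by positivity)

theorem ListsZeros.summable_norm_inv_pow (hG : ListsZeros G ζ) (hd : Differentiable ℂ G)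
    (h0 : G 0 ≠ 0) (hρ : 0 < ρ) (hgrowth : HasExpGrowth ρ G) {n : ℕ} (hn : ρ < n) :
    Summable fun i => ‖(ζ i ^ n)⁻¹‖ := by
  obtain ⟨D, hD⟩ := hG.exists_card_le hd h0 hρ.le hgrowth
  refine (summable_rpow_neg_of_card_le hρ hn (fun i => norm_pos_iff.2 (hG.ne_zero h0 i)) hD).congr
    fun i => ?_
  rw [Real.rpow_neg (norm_nonneg _), Real.rpow_natCast, norm_inv, norm_pow]

theorem ListsZeros.finite_setOf_norm_le (hG : ListsZeros G ζ) (hd : Differentiable ℂ G)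
    (h0 : G 0 ≠ 0) (hρ : 0 ≤ ρ) (hgrowth : HasExpGrowth ρ G) {R : ℝ} (hR : 0 ≤ R) :
    {i | ‖ζ i‖ ≤ R}.Finite := by
  obtain ⟨D, hD⟩ := hG.exists_card_le hd h0 hρ hgrowth
  by_contra hinf
  obtain ⟨s, hs, hcard⟩ := Set.Infinite.exists_subset_card_eq hinf (⌊D * R ^ ρ⌋₊ + 1)
  have hle := hD R hR s fun i hi => hs hi
  rw [hcard, Nat.cast_succ] at hle
  exact absurd hle (not_le.2 (Nat.lt_floor_add_one _))

end Zeros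

theorem exists_log_on_ball {g : ℂ → ℂ} {c : ℂ} {R : ℝ} (hd : DifferentiableOn ℂ g (Metric.ball c R))
    (hg : ∀ w ∈ Metric.ball c R, g w ≠ 0) :
    ∃ h : ℂ → ℂ, h c = 0 ∧ DifferentiableOn ℂ h (Metric.ball c R) ∧
      ∀ w ∈ Metric.ball c R, g w = g c * Complex.exp (h w) := by
  obtain ⟨h, h0, hh⟩ := ((hd.deriv Metric.isOpen_ball).div hd hg).isExactOn_ball.with_val_at c 0
  refine ⟨h, h0, fun w hw => (hh w hw).differentiableAt.differentiableWithinAt, fun w hw => ?_⟩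
  have hderiv : ∀ x ∈ Metric.ball c R, HasDerivAt (fun w => g w * Complex.exp (-h w)) 0 x := by
    intro x hx
    have hgx := (hd.differentiableAt (Metric.isOpen_ball.mem_nhds hx)).hasDerivAt
    refine (hgx.mul (hh x hx).neg.cexp).congr_deriv ?_
    simp only [Pi.div_apply]
    field_simp [hg x hx]
    ring
  have hconst := Metric.isOpen_ball.is_const_of_deriv_eq_zero (convex_ball c R).isPreconnected
    (fun x hx => (hderiv x hx).differentiableAt.differentiableWithinAt)
    (fun x hx => (hderiv x hx).deriv) hw (Metric.mem_ball_self (Metric.pos_of_mem_ball hw))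
  simp only [h0, neg_zero, Complex.exp_zero, mul_one] at hconst
  rw [← hconst, mul_assoc, ← Complex.exp_add, neg_add_cancel, Complex.exp_zero, mul_one]

theorem exists_eq_mul_exp_of_norm_le {g : ℂ → ℂ} {R L : ℝ}
    (hd : DifferentiableOn ℂ g (Metric.ball 0 R)) (hg : ∀ w ∈ Metric.ball (0 : ℂ) R, g w ≠ 0)
    (hL : 0 < L) (hle : ∀ w ∈ Metric.ball (0 : ℂ) R, ‖g w‖ ≤ ‖g 0‖ * Real.exp L) {w : ℂ}
    (hw : w ∈ Metric.ball (0 : ℂ) R) :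
    ∃ z : ℂ, g w = g 0 * Complex.exp z ∧ ‖z‖ ≤ 2 * L * ‖w‖ / (R - ‖w‖) := by
  obtain ⟨h, h0, hhd, hexp⟩ := exists_log_on_ball hd hg
  have hR : 0 < R := Metric.pos_of_mem_ball hw
  have hg0 : 0 < ‖g 0‖ := norm_pos_iff.2 (hg 0 (Metric.mem_ball_self hR))
  have hre : Set.MapsTo h (Metric.ball 0 R) {z | z.re ≤ L} := fun x hx => by
    have hx' := hle x hx
    rw [hexp x hx, norm_mul, Complex.norm_exp] at hx'
    exact Real.exp_le_exp.1 (le_of_mul_le_mul_left hx' hg0)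
  exact ⟨h w, hexp w hw, Complex.borelCaratheodory_zero hL hhd hre hR hw h0⟩

theorem tendsto_rpow_div_sub {ρ : ℝ} (hρ : ρ < 1) (A B x : ℝ) :
    Tendsto (fun R : ℝ => (A + B * R ^ ρ) * x / (R - x)) atTop (𝓝 0) := by
  have hinv : Tendsto (fun R : ℝ => R⁻¹) atTop (𝓝 0) := tendsto_inv_atTop_zero
  have hpow : Tendsto (fun R : ℝ => R ^ (-(1 - ρ))) atTop (𝓝 0) :=
    tendsto_rpow_neg_atTop (sub_pos.2 hρ)
  have hlim : Tendsto (fun R : ℝ => (A * R⁻¹ + B * R ^ (-(1 - ρ))) * x / (1 - x * R⁻¹)) atTop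
      (𝓝 ((A * 0 + B * 0) * x / (1 - x * 0))) :=
    (((hinv.const_mul A).add (hpow.const_mul B)).mul_const x).div
      (tendsto_const_nhds.sub (hinv.const_mul x)) (by simp)
  simp only [mul_zero, add_zero, zero_mul, zero_div] at hlim
  refine hlim.congr' ?_
  filter_upwards [eventually_gt_atTop 0] with R hR
  rw [neg_sub, Real.rpow_sub_one hR.ne']
  field_simp

section Hadamard

variable {ι : Type*} {G : ℂ → ℂ} {ζ : ι → ℂ} {ρ : ℝ}

theorem IsCofactor.exists_eq_mul_exp_norm_le {s : Finset ι} {g : ℂ → ℂ} (hg : IsCofactor G ζ s g)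
    (hG : ListsZeros G ζ) (h0 : G 0 ≠ 0) {K R : ℝ} (hK : 0 ≤ K)
    (hgrowth : ∀ w, ‖G w‖ ≤ Real.exp (K * (1 + ‖w‖ ^ ρ))) (hs : ∀ i, i ∈ s ↔ ‖ζ i‖ ≤ R) {w : ℂ}
    (hw : ‖w‖ < R) :
    ∃ z : ℂ, g w = G 0 * Complex.exp z ∧
      ‖z‖ ≤ (2 * (K + |Real.log ‖G 0‖| + 1) + 2 * K * 2 ^ ρ * R ^ ρ) * ‖w‖ / (R - ‖w‖) := by
  have hR : 0 < R := (norm_nonneg w).trans_lt hw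
  have hne : ∀ z ∈ Metric.ball (0 : ℂ) R, g z ≠ 0 := fun z hz =>
    hg.apply_ne_zero fun i hi => (hs i).2 (hi ▸ (mem_ball_zero_iff.1 hz).le)
  have hle : ∀ z ∈ Metric.ball (0 : ℂ) R, ‖g z‖ ≤
      ‖g 0‖ * Real.exp (K * (1 + (2 * R) ^ ρ) + |Real.log ‖G 0‖| + 1) := by
    intro z hz
    have hbound := hg.norm_mul_pow_le hR zero_le_one
      (fun i hi => ⟨hG.ne_zero h0 i, (hs i).1 hi⟩)
      (fun z hz => hz ▸ hgrowth z) (w := z) (by linarith [mem_ball_zero_iff.1 hz])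
    rw [one_pow, mul_one, one_add_one_eq_two] at hbound
    refine hbound.trans ?_
    rw [hg.apply_zero]
    nth_rewrite 1 [← Real.exp_log (norm_pos_iff.2 h0)]
    rw [← Real.exp_add]
    gcongr
    linarith [neg_abs_le (Real.log ‖G 0‖)]
  obtain ⟨z, hz, hzle⟩ := exists_eq_mul_exp_of_norm_le hg.differentiable.differentiableOn hne
    (by positivity) hle (mem_ball_zero_iff.2 hw)
  refine ⟨z, by rwa [← hg.apply_zero], hzle.trans_eq ?_⟩
  rw [Real.mul_rpow zero_le_two hR.le]
  ring

theorem ListsZeros.multipliable (hG : ListsZeros G ζ) (hd : Differentiable ℂ G) (h0 : G 0 ≠ 0)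
    (hρ0 : 0 < ρ) (hρ : ρ < 1) (hgrowth : HasExpGrowth ρ G) (w : ℂ) :
    Multipliable fun i => 1 - (ζ i)⁻¹ * w := by
  have hsum := hG.summable_norm_inv_pow hd h0 hρ0 hgrowth (n := 1) (by simpa using hρ)
  simp only [pow_one] at hsum
  simpa [sub_eq_add_neg] using multipliable_one_add_of_summable (f := fun i => -((ζ i)⁻¹ * w))
    (by simpa using hsum.mul_right ‖w‖)

/-- Hadamard's factorization in order less than `1`: removing the zeros in the disc of radius `R`
leaves a function which has a logarithm there of size `O(R ^ ρ)`, and by Borel–Carathéodory this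
logarithm tends to `0` at every fixed point. -/
theorem ListsZeros.eq_mul_tprod (hG : ListsZeros G ζ) (hd : Differentiable ℂ G) (h0 : G 0 ≠ 0)
    (hρ0 : 0 < ρ) (hρ : ρ < 1) (hgrowth : HasExpGrowth ρ G) (w : ℂ) :
    G w = G 0 * ∏' i, (1 - (ζ i)⁻¹ * w) := by
  have hfin : ∀ n : ℕ, {i | ‖ζ i‖ ≤ n}.Finite := fun n =>
    hG.finite_setOf_norm_le hd h0 hρ0.le hgrowth n.cast_nonneg
  let s : ℕ → Finset ι := fun n => (hfin n).toFinset
  have hs : ∀ n i, i ∈ s n ↔ ‖ζ i‖ ≤ n := fun n i => (hfin n).mem_toFinset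
  choose g hg using fun n => hG.exists_isCofactor hd h0 (s n)
  have hprod : Tendsto (fun n => ∏ i ∈ s n, (1 - (ζ i)⁻¹ * w)) atTop
      (𝓝 (∏' i, (1 - (ζ i)⁻¹ * w))) := by
    refine (hG.multipliable hd h0 hρ0 hρ hgrowth w).hasProd.comp ?_
    refine tendsto_atTop_finset_of_monotone (fun m n hmn i hi => ?_) fun i => ?_
    · exact (hs n i).2 (((hs m i).1 hi).trans (by exact_mod_cast hmn))
    · obtain ⟨n, hn⟩ := exists_nat_ge ‖ζ i‖
      exact ⟨n, (hs n i).2 hn⟩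
  have hcofactor : Tendsto (fun n => g n w) atTop (𝓝 (G 0)) := by
    obtain ⟨K, hK, hgrowth⟩ := hgrowth
    have hlog : ∀ n : ℕ, ‖w‖ < n → _ := fun n hn =>
      (hg n).exists_eq_mul_exp_norm_le hG h0 hK hgrowth (hs n) hn
    choose! z hz hzle using hlog
    have hlarge : ∀ᶠ n : ℕ in atTop, ‖w‖ < n :=
      tendsto_natCast_atTop_atTop.eventually_gt_atTop ‖w‖
    have hz0 : Tendsto z atTop (𝓝 0) :=
      squeeze_zero_norm' (hlarge.mono hzle)
        ((tendsto_rpow_div_sub hρ _ _ _).comp tendsto_natCast_atTop_atTop)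
    have hexp := (Complex.continuous_exp.tendsto 0).comp hz0 |>.const_mul (G 0)
    rw [Complex.exp_zero, mul_one] at hexp
    exact hexp.congr' (hlarge.mono fun n hn => (hz n hn).symm)
  rw [mul_comm]
  exact tendsto_nhds_unique tendsto_const_nhds
    ((hprod.mul hcofactor).congr fun n => ((hg n).eq_prod_mul w).symm)

theorem ListsZeros.exists_polynomial_of_finite [Finite ι] (hG : ListsZeros G ζ)
    (hd : Differentiable ℂ G) (h0 : G 0 ≠ 0) (hρ0 : 0 < ρ) (hρ : ρ < 1)
    (hgrowth : HasExpGrowth ρ G) : ∃ P : Polynomial ℂ, ∀ w, G w = P.eval w := by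
  cases nonempty_fintype ι
  refine ⟨.C (G 0) * ∏ i, (1 - .C (ζ i)⁻¹ * .X), fun w => ?_⟩
  rw [hG.eq_mul_tprod hd h0 hρ0 hρ hgrowth w, tprod_fintype]
  simp [Polynomial.eval_prod]

theorem ListsZeros.summable_inv_sub (hG : ListsZeros G ζ) (hd : Differentiable ℂ G) (h0 : G 0 ≠ 0)
    (hρ0 : 0 < ρ) (hρ : ρ < 1) (hgrowth : HasExpGrowth ρ G) (w : ℂ) :
    Summable fun i => (ζ i - w)⁻¹ := by
  have hsum := hG.summable_norm_inv_pow hd h0 hρ0 hgrowth (n := 1) (by simpa using hρ)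
  refine (hsum.mul_left 2).of_norm_bounded_eventually ?_
  have hfin := hG.finite_setOf_norm_le hd h0 hρ0.le hgrowth
    (R := 2 * ‖w‖) (by positivity)
  filter_upwards [hfin.compl_mem_cofinite] with i hi
  replace hi : 2 * ‖w‖ < ‖ζ i‖ := not_le.1 hi
  have hpos : 0 < ‖ζ i‖ := norm_pos_iff.2 (hG.ne_zero h0 i)
  have hhalf : ‖ζ i‖ / 2 ≤ ‖ζ i - w‖ := by linarith [norm_sub_norm_le (ζ i) w]
  calc ‖(ζ i - w)⁻¹‖ = ‖ζ i - w‖⁻¹ := norm_inv _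
    _ ≤ (‖ζ i‖ / 2)⁻¹ := by gcongr
    _ = 2 * ‖(ζ i ^ 1)⁻¹‖ := by rw [inv_div, pow_one, norm_inv, div_eq_mul_inv]

theorem logDeriv_one_sub_inv_mul {x : ℂ} (hx : x ≠ 0) (w : ℂ) :
    logDeriv (fun z => 1 - x⁻¹ * z) w = -(x - w)⁻¹ := by
  have hderiv : HasDerivAt (fun z => 1 - x⁻¹ * z) (-x⁻¹) w := by
    simpa using ((hasDerivAt_id w).const_mul x⁻¹).const_sub 1
  rw [logDeriv_apply, hderiv.deriv, neg_div, inv_div_left, sub_mul, one_mul,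
    mul_right_comm, inv_mul_cancel₀ hx, one_mul]

theorem ListsZeros.logDeriv_eq (hG : ListsZeros G ζ) (hd : Differentiable ℂ G) (h0 : G 0 ≠ 0)
    (hρ0 : 0 < ρ) (hρ : ρ < 1) (hgrowth : HasExpGrowth ρ G) {w : ℂ} (hw : G w ≠ 0) :
    logDeriv G w = -∑' i, (ζ i - w)⁻¹ := by
  have hprod : G = fun z => G 0 * ∏' i, (1 - (ζ i)⁻¹ * z) :=
    funext (hG.eq_mul_tprod hd h0 hρ0 hρ hgrowth)
  have hsum := hG.summable_norm_inv_pow hd h0 hρ0 hgrowth (n := 1) (by simpa using hρ)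
  have hfactor : ∀ i, 1 - (ζ i)⁻¹ * w ≠ 0 := fun i hi => hw <| by
    have hiw : ζ i = w := by
      have := hG.ne_zero h0 i
      field_simp at hi
      rw [mul_zero] at hi
      exact sub_eq_zero.1 hi
    exact hiw ▸ hG.apply_eq_zero i
  have hlog : ∀ i, logDeriv (fun z => 1 - (ζ i)⁻¹ * z) w = -(ζ i - w)⁻¹ := fun i =>
    logDeriv_one_sub_inv_mul (hG.ne_zero h0 i) w
  have hloc : MultipliableLocallyUniformlyOn (fun i z => 1 - (ζ i)⁻¹ * z)
      (Metric.ball 0 (‖w‖ + 1)) := by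
    simp only [sub_eq_add_neg]
    refine Summable.multipliableLocallyUniformlyOn_one_add Metric.isOpen_ball
      (hsum.mul_right (‖w‖ + 1)) (.of_forall fun i z hz => ?_) fun i => by fun_prop
    rw [norm_neg, norm_mul, pow_one]
    gcongr
    exact (mem_ball_zero_iff.1 hz).le
  rw [hprod, logDeriv_const_mul _ _ h0, logDeriv_tprod_eq_tsum Metric.isOpen_ball
    (mem_ball_zero_iff.2 (lt_add_one _)) hfactor (fun i => by fun_prop)
    (by simpa only [hlog] using (hG.summable_inv_sub hd h0 hρ0 hρ hgrowth w).neg) hloc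
    fun hzero => hw (by rw [hprod]; simp [hzero])]
  simp only [hlog, tsum_neg]

end Hadamard

section PowerSums

variable {ι : Type*} {ζ : ι → ℂ} {δ : ℝ} {w : ℂ}

theorem hasSum_inv_pow_succ_mul_pow {x : ℂ} (hx : ‖w‖ < ‖x‖) :
    HasSum (fun n : ℕ => (x ^ (n + 1))⁻¹ * w ^ n) (x - w)⁻¹ := by
  have hx0 : x ≠ 0 := norm_pos_iff.1 ((norm_nonneg w).trans_lt hx)
  have hlt : ‖w / x‖ < 1 := by rwa [norm_div, div_lt_one ((norm_nonneg w).trans_lt hx)]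
  convert! (hasSum_geometric_of_norm_lt_one hlt).mul_left x⁻¹ using 1
  · ext n
    rw [div_pow, pow_succ]
    field_simp
  · rw [← mul_inv, mul_sub, mul_one, mul_div_cancel₀ _ hx0]

theorem hasSum_tsum_inv_pow_succ_mul_pow (hsum : Summable fun i => ‖(ζ i)⁻¹‖)
    (hδ : ∀ i, δ ≤ ‖ζ i‖) (hw : ‖w‖ < δ) :
    HasSum (fun n : ℕ => (∑' i, (ζ i ^ (n + 1))⁻¹) * w ^ n) (∑' i, (ζ i - w)⁻¹) := by
  have hδ0 : 0 < δ := (norm_nonneg w).trans_lt hw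
  have hdouble : Summable fun p : ι × ℕ => (ζ p.1 ^ (p.2 + 1))⁻¹ * w ^ p.2 := by
    have hgeom := summable_geometric_of_lt_one (by positivity) ((div_lt_one hδ0).2 hw)
    refine .of_norm_bounded (hsum.mul_of_nonneg hgeom (fun i => norm_nonneg _)
      fun n => by positivity) fun p => ?_
    rw [pow_succ', mul_inv, mul_assoc, norm_mul, norm_mul, norm_inv, norm_inv, norm_pow, norm_pow,
      div_pow, div_eq_inv_mul]
    gcongr
    exact hδ p.1
  have hrow : ∀ i, HasSum (fun n : ℕ => (ζ i ^ (n + 1))⁻¹ * w ^ n) (ζ i - w)⁻¹ :=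
    fun i => hasSum_inv_pow_succ_mul_pow (hw.trans_le (hδ i))
  have htotal := hdouble.hasSum
  rw [(htotal.prod_fiberwise hrow).tsum_eq]
  have hswap := (Equiv.prodComm ℕ ι).hasSum_iff.2 htotal
  exact hswap.prod_fiberwise fun n => by
    rw [← tsum_mul_right]
    exact (hdouble.comp_injective (Prod.mk_left_injective n)).hasSum

end PowerSums

section Taylor

open PowerSeries

variable {f g : ℂ → ℂ}

/-- The Taylor series at `0` of a function of a complex variable. -/
noncomputable def taylorAtZero (f : ℂ → ℂ) : ℂ⟦X⟧ :=
  mk fun n => iteratedDeriv n f 0 / (n.factorial : ℂ)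

theorem taylorAtZero_congr (h : f =ᶠ[𝓝 0] g) : taylorAtZero f = taylorAtZero g := by
  ext n
  simp only [taylorAtZero, coeff_mk, h.iteratedDeriv_eq]

theorem taylorAtZero_add (hf : AnalyticAt ℂ f 0) (hg : AnalyticAt ℂ g 0) :
    taylorAtZero (fun w => f w + g w) = taylorAtZero f + taylorAtZero g := by
  ext n
  simp only [taylorAtZero, coeff_mk, map_add,
    iteratedDeriv_fun_add hf.contDiffAt hg.contDiffAt, add_div]

theorem taylorAtZero_mul (hf : AnalyticAt ℂ f 0) (hg : AnalyticAt ℂ g 0) :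
    taylorAtZero (fun w => f w * g w) = taylorAtZero f * taylorAtZero g := by
  ext n
  simp only [taylorAtZero, coeff_mk, coeff_mul]
  rw [iteratedDeriv_fun_mul hf.contDiffAt hg.contDiffAt, Finset.sum_div,
    Finset.Nat.sum_antidiagonal_eq_sum_range_succ_mk]
  refine Finset.sum_congr rfl fun i hi => ?_
  rw [Nat.cast_choose ℂ (Nat.lt_succ_iff.1 (Finset.mem_range.1 hi))]
  have hn := n.factorial_ne_zero
  field_simp

theorem taylorAtZero_const_mul (c : ℂ) (f : ℂ → ℂ) :
    taylorAtZero (fun w => c * f w) = C c * taylorAtZero f := by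
  ext n
  simp only [taylorAtZero, coeff_mk, coeff_C_mul, iteratedDeriv_const_mul_field, mul_div_assoc]

theorem taylorAtZero_deriv (f : ℂ → ℂ) :
    taylorAtZero (deriv f) = derivative ℂ (taylorAtZero f) := by
  ext n
  simp only [taylorAtZero, coeff_mk, coeff_derivative, iteratedDeriv_succ', Nat.factorial_succ]
  push_cast
  have := n.cast_add_one_ne_zero (R := ℂ)
  field_simp

theorem taylorAtZero_eq_mk_of_hasSum {u : ℕ → ℂ}
    (h : ∀ᶠ w in 𝓝 0, HasSum (fun n => u n * w ^ n) (f w)) : taylorAtZero f = mk u := by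
  have hseries : HasFPowerSeriesAt f (FormalMultilinearSeries.ofScalars ℂ u) 0 := by
    rw [hasFPowerSeriesAt_iff]
    simpa [FormalMultilinearSeries.coeff_ofScalars, mul_comm] using h
  have heq := hseries.analyticAt.hasFPowerSeriesAt.eq_formalMultilinearSeries hseries
  ext n
  simpa [taylorAtZero, FormalMultilinearSeries.coeff_ofScalars] using
    congrArg (fun p => p.coeff n) heq

theorem taylorAtZero_eval (P : Polynomial ℂ) : taylorAtZero (fun w => P.eval w) = P := by
  have hsum : ∀ w, HasSum (fun n => P.coeff n * w ^ n) (P.eval w) := fun w => by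
    rw [P.eval_eq_sum_range]
    refine hasSum_sum_of_ne_finset_zero fun n hn => ?_
    rw [Polynomial.coeff_eq_zero_of_natDegree_lt (by simpa using hn), zero_mul]
  rw [taylorAtZero_eq_mk_of_hasSum (.of_forall hsum)]
  ext n
  rw [coeff_mk, Polynomial.coeff_coe]

end Taylor

section EntireSeries

variable {u : ℕ → ℂ} {C : ℝ} {m : ℕ}

theorem norm_mul_pow_le_of_norm_le (hm : m ≠ 0)
    (hu : ∀ n, ‖u n‖ ≤ C / (n.factorial : ℝ) ^ m) (n : ℕ) (w : ℂ) :
    ‖u n * w ^ n‖ ≤ C * Real.exp (‖w‖ ^ (m : ℝ)⁻¹) ^ (m - 1)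
      * ((‖w‖ ^ (m : ℝ)⁻¹) ^ n / n.factorial) := by
  set y := ‖w‖ ^ (m : ℝ)⁻¹
  have hC : 0 ≤ C := by simpa using (norm_nonneg _).trans (hu 0)
  have hy : ‖w‖ = y ^ m := (Real.rpow_inv_natCast_pow (norm_nonneg w) hm).symm
  have hy0 : 0 ≤ y := by positivity
  calc ‖u n * w ^ n‖ ≤ C / (n.factorial : ℝ) ^ m * ‖w‖ ^ n := by
        rw [norm_mul, norm_pow]
        gcongr
        exact hu n
    _ = C * ((y ^ n / n.factorial) ^ (m - 1) * (y ^ n / n.factorial)) := by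
        rw [pow_sub_one_mul hm, hy, ← pow_mul, div_pow, ← pow_mul, mul_comm m n]
        ring
    _ ≤ C * (Real.exp y ^ (m - 1) * (y ^ n / n.factorial)) := by
        gcongr
        exact Real.pow_div_factorial_le_exp y hy0 n
    _ = C * Real.exp y ^ (m - 1) * (y ^ n / n.factorial) := by ring

theorem summable_norm_mul_pow_of_norm_le (hm : m ≠ 0)
    (hu : ∀ n, ‖u n‖ ≤ C / (n.factorial : ℝ) ^ m) (w : ℂ) :
    Summable fun n => ‖u n * w ^ n‖ :=
  ((Real.summable_pow_div_factorial _).mul_left _).of_nonneg_of_le (fun _ => norm_nonneg _)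
    fun n => norm_mul_pow_le_of_norm_le hm hu n w

theorem hasSum_mul_pow_of_norm_le (hm : m ≠ 0)
    (hu : ∀ n, ‖u n‖ ≤ C / (n.factorial : ℝ) ^ m) (w : ℂ) :
    HasSum (fun n => u n * w ^ n) (∑' n, u n * w ^ n) :=
  (summable_norm_mul_pow_of_norm_le hm hu w).of_norm.hasSum

theorem differentiable_tsum_mul_pow_of_norm_le (hm : m ≠ 0)
    (hu : ∀ n, ‖u n‖ ≤ C / (n.factorial : ℝ) ^ m) :
    Differentiable ℂ fun w => ∑' n, u n * w ^ n := by
  intro w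
  have hball : DifferentiableOn ℂ (fun w => ∑' n, u n * w ^ n) (Metric.ball 0 (‖w‖ + 1)) := by
    refine Complex.differentiableOn_tsum_of_summable_norm
      (summable_norm_mul_pow_of_norm_le hm hu (‖w‖ + 1 : ℝ)) (fun n => by fun_prop)
      Metric.isOpen_ball fun n z hz => ?_
    rw [norm_mul, norm_mul, norm_pow, norm_pow, Complex.norm_of_nonneg (by positivity)]
    gcongr
    exact (mem_ball_zero_iff.1 hz).le
  exact hball.differentiableAt (Metric.isOpen_ball.mem_nhds (mem_ball_zero_iff.2 (lt_add_one _)))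

theorem hasExpGrowth_tsum_mul_pow_of_norm_le (hm : m ≠ 0)
    (hu : ∀ n, ‖u n‖ ≤ C / (n.factorial : ℝ) ^ m) :
    HasExpGrowth (m : ℝ)⁻¹ fun w => ∑' n, u n * w ^ n := by
  have hC : 0 ≤ C := by simpa using (norm_nonneg _).trans (hu 0)
  refine ⟨C + m, by positivity, fun w => ?_⟩
  set y := ‖w‖ ^ (m : ℝ)⁻¹
  have hy : 0 ≤ y := by positivity
  calc ‖∑' n, u n * w ^ n‖ ≤ C * Real.exp y ^ (m - 1) * Real.exp y := by
        refine tsum_of_norm_bounded (HasSum.mul_left _ ?_)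
          fun n => norm_mul_pow_le_of_norm_le hm hu n w
        rw [Real.exp_eq_exp_ℝ]
        exact NormedSpace.expSeries_div_hasSum_exp y
    _ = C * Real.exp (m * y) := by
        rw [mul_assoc, pow_sub_one_mul hm, Real.exp_nat_mul]
    _ ≤ Real.exp C * Real.exp (m * y) := by
        gcongr
        linarith [Real.add_one_le_exp C]
    _ ≤ Real.exp ((C + m) * (1 + y)) := by
        rw [← Real.exp_add, Real.exp_le_exp]
        nlinarith [mul_nonneg hC hy, m.cast_nonneg (α := ℝ)]

end EntireSeries

section PowerSumSeries

open PowerSeries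

variable {ι : Type*} {G : ℂ → ℂ} {ζ : ι → ℂ} {ρ : ℝ}

/-- The generating series, without constant term, of the sums `∑ᵢ ζᵢ⁻ⁿ`, `n ≥ 1`. -/
noncomputable def powerSumSeries (ζ : ι → ℂ) : ℂ⟦X⟧ :=
  X * mk fun n => ∑' i, (ζ i ^ (n + 1))⁻¹

theorem coeff_zero_powerSumSeries (ζ : ι → ℂ) : coeff 0 (powerSumSeries ζ) = 0 :=
  coeff_zero_X_mul _

theorem coeff_powerSumSeries (ζ : ι → ℂ) {n : ℕ} (hn : n ≠ 0) :
    coeff n (powerSumSeries ζ) = ∑' i, (ζ i ^ n)⁻¹ := by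
  obtain ⟨n, rfl⟩ := Nat.exists_eq_succ_of_ne_zero hn
  rw [powerSumSeries, coeff_succ_X_mul, coeff_mk]

theorem ListsZeros.X_mul_derivative_taylorAtZero (hG : ListsZeros G ζ) (hd : Differentiable ℂ G)
    (h0 : G 0 ≠ 0) (hρ0 : 0 < ρ) (hρ : ρ < 1) (hgrowth : HasExpGrowth ρ G) :
    X * derivative ℂ (taylorAtZero G) = -(powerSumSeries ζ * taylorAtZero G) := by
  have hsum := hG.summable_norm_inv_pow hd h0 hρ0 hgrowth (n := 1) (by simpa using hρ)
  simp only [pow_one] at hsum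
  obtain ⟨δ, hδ, hle⟩ := hG.exists_pos_le_norm hd.continuous.continuousAt h0
  have hlogDeriv : ∀ᶠ w in 𝓝 0,
      HasSum (fun n => -(∑' i, (ζ i ^ (n + 1))⁻¹) * w ^ n) (logDeriv G w) := by
    filter_upwards [hd.continuous.continuousAt.eventually_ne h0, Metric.ball_mem_nhds 0 hδ]
      with w hw hwδ
    rw [hG.logDeriv_eq hd h0 hρ0 hρ hgrowth hw]
    simpa only [neg_mul] using
      (hasSum_tsum_inv_pow_succ_mul_pow hsum hle (mem_ball_zero_iff.1 hwδ)).neg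
  have hderiv : deriv G =ᶠ[𝓝 0] fun w => logDeriv G w * G w := by
    filter_upwards [hd.continuous.continuousAt.eventually_ne h0] with w hw
    rw [logDeriv_apply, div_mul_cancel₀ _ hw]
  have hanalytic : AnalyticAt ℂ (logDeriv G) 0 := (hd.analyticAt 0).deriv.div (hd.analyticAt 0) h0
  have hneg : (mk fun n => -∑' i, (ζ i ^ (n + 1))⁻¹) = -mk fun n => ∑' i, (ζ i ^ (n + 1))⁻¹ := by
    ext n
    simp
  rw [← taylorAtZero_deriv, taylorAtZero_congr hderiv, taylorAtZero_mul hanalytic (hd.analyticAt 0),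
    taylorAtZero_eq_mk_of_hasSum hlogDeriv, hneg, powerSumSeries]
  ring

end PowerSumSeries

section TwistedEuler

open PowerSeries

variable {f : ℂ → ℂ} {ρ : ℝ}

/-- The operator `f ↦ μ f + 2 w f'`, which describes differentiation of functions of the form
`z ^ μ * f (z ^ 2)`, see `hasDerivAt_cpow_mul_comp_sq`. -/
noncomputable def twistedEuler (μ : ℂ) (f : ℂ → ℂ) (w : ℂ) : ℂ :=
  μ * f w + 2 * w * deriv f w

theorem cpow_sub_one_mul_self {z : ℂ} (hz : z ≠ 0) (μ : ℂ) : z ^ (μ - 1) * z = z ^ μ := by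
  rw [Complex.cpow_sub _ _ hz, Complex.cpow_one, div_mul_cancel₀ _ hz]

theorem hasDerivAt_cpow_mul_comp_sq (hf : Differentiable ℂ f) (μ : ℂ) {z : ℂ}
    (hz : z ∈ Complex.slitPlane) :
    HasDerivAt (fun z => z ^ μ * f (z ^ 2)) (z ^ (μ - 1) * twistedEuler μ f (z ^ 2)) z := by
  have hsq : HasDerivAt (fun z : ℂ => f (z ^ 2)) (deriv f (z ^ 2) * (2 * z)) z :=
    (hf (z ^ 2)).hasDerivAt.comp z (by simpa using hasDerivAt_pow 2 z)
  refine ((hasDerivAt_id z).cpow_const hz |>.mul hsq).congr_deriv ?_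
  simp only [id_eq, mul_one, ← cpow_sub_one_mul_self (Complex.slitPlane_ne_zero hz) μ, twistedEuler]
  ring

theorem deriv_eqOn_of_eqOn_cpow_mul_comp_sq {F : ℂ → ℂ} {μ : ℂ} (hf : Differentiable ℂ f)
    (h : Set.EqOn F (fun z => z ^ μ * f (z ^ 2)) Complex.slitPlane) :
    Set.EqOn (deriv F) (fun z => z ^ (μ - 1) * twistedEuler μ f (z ^ 2)) Complex.slitPlane :=
  fun _ hz => ((hasDerivAt_cpow_mul_comp_sq hf μ hz).congr_of_eventuallyEq
    (h.eventuallyEq_of_mem (Complex.isOpen_slitPlane.mem_nhds hz))).deriv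

theorem differentiable_twistedEuler (hf : Differentiable ℂ f) (μ : ℂ) :
    Differentiable ℂ (twistedEuler μ f) :=
  (hf.const_mul μ).add ((differentiable_id.const_mul 2).mul hf.deriv)

theorem HasExpGrowth.twistedEuler (hρ : 0 < ρ) (hf : Differentiable ℂ f) (h : HasExpGrowth ρ f)
    (μ : ℂ) : HasExpGrowth ρ (twistedEuler μ f) :=
  ((const ρ μ).mul h).add (((const ρ 2).mul (.id hρ)).mul (h.deriv hρ.le hf))

theorem taylorAtZero_twistedEuler (hf : Differentiable ℂ f) (μ : ℂ) :
    taylorAtZero (twistedEuler μ f) =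
      C μ * taylorAtZero f + 2 * X * derivative ℂ (taylorAtZero f) := by
  have hlinear : taylorAtZero (fun w => 2 * w) = 2 * X := by
    rw [taylorAtZero_const_mul, map_ofNat]
    congr 1
    simpa using taylorAtZero_eval Polynomial.X
  have hd : Differentiable ℂ fun w => 2 * w * deriv f w :=
    (differentiable_id.const_mul 2).mul hf.deriv
  rw [← taylorAtZero_const_mul, ← taylorAtZero_deriv, ← hlinear,
    ← taylorAtZero_mul (by fun_prop) (hf.analyticAt 0).deriv,
    ← taylorAtZero_add ((hf.const_mul μ).analyticAt 0) (hd.analyticAt 0)]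
  rfl

theorem coeff_taylorAtZero_twistedEuler (hf : Differentiable ℂ f) (μ : ℂ) (n : ℕ) :
    coeff n (taylorAtZero (twistedEuler μ f)) = (μ + 2 * n) * coeff n (taylorAtZero f) := by
  rw [taylorAtZero_twistedEuler hf, map_add, coeff_C_mul, mul_assoc,
    ← map_ofNat (C (R := ℂ)) 2, coeff_C_mul]
  rcases n with _ | n
  · simp
  · rw [coeff_succ_X_mul, coeff_derivative]
    push_cast
    ring

end TwistedEuler

section Bessel

open PowerSeries

variable {ν : ℂ}

/-- The coefficients of `z ^ (-ν) * J_ν z` as a power series in `z ^ 2`. -/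
noncomputable def besselCoeff (ν : ℂ) (n : ℕ) : ℂ :=
  2 ^ (-ν) * ((-1) ^ n / (4 ^ n * n.factorial * Complex.Gamma (ν + n + 1)))

/-- The entire function `H` with `J_ν z = z ^ ν * H (z ^ 2)`. -/
noncomputable def besselEntire (ν w : ℂ) : ℂ := ∑' n, besselCoeff ν n * w ^ n

/-- The entire function `G` with `N_ν z = z ^ ν * G (z ^ 2)`. -/
noncomputable def besselNEntire (a b c ν w : ℂ) : ℂ :=
  a * twistedEuler (ν - 1) (twistedEuler ν (besselEntire ν)) w
    + b * twistedEuler ν (besselEntire ν) w + c * besselEntire ν w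

theorem Gamma_add_natCast_add_one_ne_zero (hν : ∀ n : ℕ, ν ≠ -((n : ℂ) + 1)) (n : ℕ) :
    Complex.Gamma (ν + n + 1) ≠ 0 := Complex.Gamma_ne_zero fun m hm => by
  refine hν (n + m) ?_
  push_cast
  linear_combination hm

theorem besselCoeff_ne_zero (hν : ∀ n : ℕ, ν ≠ -((n : ℂ) + 1)) (n : ℕ) : besselCoeff ν n ≠ 0 := by
  have htwo : (2 : ℂ) ^ (-ν) ≠ 0 := by simp [Complex.cpow_eq_zero_iff]
  have hfactorial : (n.factorial : ℂ) ≠ 0 := by exact_mod_cast n.factorial_ne_zero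
  have hGamma := Gamma_add_natCast_add_one_ne_zero hν n
  exact mul_ne_zero htwo (div_ne_zero (by simp) (by simp [hfactorial, hGamma]))

theorem besselCoeff_succ (hν : ∀ n : ℕ, ν ≠ -((n : ℂ) + 1)) (n : ℕ) :
    4 * (n + 1) * (ν + n + 1) * besselCoeff ν (n + 1) = -besselCoeff ν n := by
  have hshift : ν + n + 1 ≠ 0 := fun h => hν n (by linear_combination h)
  have hGamma_ne := Gamma_add_natCast_add_one_ne_zero hν n
  have hfactorial : (n.factorial : ℂ) ≠ 0 := by exact_mod_cast n.factorial_ne_zero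
  have hsucc : (n : ℂ) + 1 ≠ 0 := by exact_mod_cast n.succ_ne_zero
  have hGamma : Complex.Gamma (ν + (n + 1 : ℕ) + 1) =
      (ν + n + 1) * Complex.Gamma (ν + n + 1) := by
    rw [← Complex.Gamma_add_one _ hshift]
    push_cast
    ring_nf
  rw [besselCoeff, besselCoeff, hGamma, Nat.factorial_succ]
  push_cast
  field_simp
  ring

theorem norm_besselCoeff_succ_le (hν : ∀ n : ℕ, ν ≠ -((n : ℂ) + 1)) {n : ℕ} (hn : 2 * ‖ν‖ ≤ n) :
    ‖besselCoeff ν (n + 1)‖ * ((n + 1).factorial : ℝ) ^ 2 ≤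
      ‖besselCoeff ν n‖ * (n.factorial : ℝ) ^ 2 := by
  have hnorm : ‖(n : ℂ) + 1‖ = n + 1 := by exact_mod_cast Complex.norm_natCast (n + 1)
  have hlower : (n + 1 : ℝ) ≤ 4 * ‖ν + n + 1‖ := by
    have htriangle := norm_sub_le (ν + n + 1) ν
    rw [add_assoc, add_sub_cancel_left, hnorm] at htriangle
    rw [add_assoc]
    linarith [norm_nonneg ν, n.cast_nonneg (α := ℝ)]
  have hrec := congrArg norm (besselCoeff_succ hν n)
  rw [norm_neg, norm_mul, norm_mul, norm_mul, hnorm, Complex.norm_ofNat] at hrec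
  rw [← hrec, Nat.factorial_succ]
  push_cast
  calc ‖besselCoeff ν (n + 1)‖ * ((n + 1) * n.factorial) ^ 2
      = (n + 1) * ((n + 1) * ‖besselCoeff ν (n + 1)‖ * (n.factorial : ℝ) ^ 2) := by ring
    _ ≤ 4 * ‖ν + n + 1‖ * ((n + 1) * ‖besselCoeff ν (n + 1)‖ * (n.factorial : ℝ) ^ 2) := by
        gcongr
    _ = 4 * (n + 1) * ‖ν + n + 1‖ * ‖besselCoeff ν (n + 1)‖ * (n.factorial : ℝ) ^ 2 := by ring

theorem exists_norm_besselCoeff_le (hν : ∀ n : ℕ, ν ≠ -((n : ℂ) + 1)) :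
    ∃ C : ℝ, ∀ n, ‖besselCoeff ν n‖ ≤ C / (n.factorial : ℝ) ^ 2 := by
  obtain ⟨N, hN⟩ := exists_nat_ge (2 * ‖ν‖)
  have hanti : AntitoneOn (fun n => ‖besselCoeff ν n‖ * (n.factorial : ℝ) ^ 2) (Set.Ici N) :=
    antitoneOn_nat_Ici_of_succ_le fun n hn =>
      norm_besselCoeff_succ_le hν (hN.trans (by exact_mod_cast hn))
  have hbdd : IsBoundedUnder (· ≤ ·) atTop
      fun n => ‖besselCoeff ν n‖ * (n.factorial : ℝ) ^ 2 :=
    isBoundedUnder_of_eventually_le ((eventually_ge_atTop N).mono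
      fun n hn => hanti Set.self_mem_Ici hn hn)
  obtain ⟨C, hC⟩ := hbdd.bddAbove_range
  exact ⟨C, fun n => (le_div_iff₀ (by positivity)).2 (hC ⟨n, rfl⟩)⟩

theorem differentiable_besselEntire (hν : ∀ n : ℕ, ν ≠ -((n : ℂ) + 1)) :
    Differentiable ℂ (besselEntire ν) := by
  obtain ⟨C, hC⟩ := exists_norm_besselCoeff_le hν
  exact differentiable_tsum_mul_pow_of_norm_le two_ne_zero hC

theorem hasExpGrowth_besselEntire (hν : ∀ n : ℕ, ν ≠ -((n : ℂ) + 1)) :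
    HasExpGrowth 2⁻¹ (besselEntire ν) := by
  obtain ⟨C, hC⟩ := exists_norm_besselCoeff_le hν
  exact_mod_cast hasExpGrowth_tsum_mul_pow_of_norm_le two_ne_zero hC

theorem taylorAtZero_besselEntire (hν : ∀ n : ℕ, ν ≠ -((n : ℂ) + 1)) :
    taylorAtZero (besselEntire ν) = mk (besselCoeff ν) := by
  obtain ⟨C, hC⟩ := exists_norm_besselCoeff_le hν
  exact taylorAtZero_eq_mk_of_hasSum (.of_forall (hasSum_mul_pow_of_norm_le two_ne_zero hC))

theorem div_two_cpow {z : ℂ} (hz : z ≠ 0) (ν : ℂ) : (z / 2) ^ ν = z ^ ν * 2 ^ (-ν) := by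
  have hlog : Complex.log (z / 2) = Complex.log z - Complex.log 2 := by
    have h := Complex.log_mul_ofReal 2⁻¹ (by norm_num) z hz
    rw [Real.log_inv, Complex.ofReal_neg, Complex.ofReal_log zero_le_two] at h
    push_cast at h
    rw [div_eq_mul_inv, h]
    ring
  rw [Complex.cpow_def_of_ne_zero (by simpa using hz), Complex.cpow_def_of_ne_zero hz,
    Complex.cpow_def_of_ne_zero two_ne_zero, ← Complex.exp_add, hlog]
  ring_nf

theorem besselJ_eq_cpow_mul {z : ℂ} (hz : z ≠ 0) (ν : ℂ) :
    besselJ ν z = z ^ ν * besselEntire ν (z ^ 2) := by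
  rw [besselJ, besselEntire, ← tsum_mul_left]
  refine tsum_congr fun n => ?_
  have hpow : (z / 2) ^ (2 * (n : ℂ) + ν) = (z ^ 2) ^ n / 4 ^ n * (z ^ ν * 2 ^ (-ν)) := by
    rw [Complex.cpow_add _ _ (by simpa using hz), div_two_cpow hz ν, mul_comm 2 (n : ℂ),
      Complex.cpow_nat_mul, Complex.cpow_ofNat, div_pow, div_pow]
    norm_num
  rw [hpow, besselCoeff]
  ring

theorem besselN_eq_cpow_mul (a b c : ℂ) (hν : ∀ n : ℕ, ν ≠ -((n : ℂ) + 1)) {z : ℂ}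
    (hz : z ∈ Complex.slitPlane) :
    besselN a b c ν z = z ^ ν * besselNEntire a b c ν (z ^ 2) := by
  have hH := differentiable_besselEntire hν
  have hderiv := deriv_eqOn_of_eqOn_cpow_mul_comp_sq hH fun x hx =>
    besselJ_eq_cpow_mul (Complex.slitPlane_ne_zero hx) ν
  have hderiv₂ := deriv_eqOn_of_eqOn_cpow_mul_comp_sq (differentiable_twistedEuler hH ν) hderiv
  have hz0 := Complex.slitPlane_ne_zero hz
  rw [besselN, iteratedDeriv_succ, iteratedDeriv_one, hderiv₂ hz, hderiv hz,
    besselJ_eq_cpow_mul hz0, besselNEntire]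
  simp only [← cpow_sub_one_mul_self hz0 ν, ← cpow_sub_one_mul_self hz0 (ν - 1)]
  ring

theorem differentiable_besselNEntire (a b c : ℂ) (hν : ∀ n : ℕ, ν ≠ -((n : ℂ) + 1)) :
    Differentiable ℂ (besselNEntire a b c ν) := by
  have hH := differentiable_besselEntire hν
  have hv := differentiable_twistedEuler hH ν
  exact (((differentiable_twistedEuler hv (ν - 1)).const_mul a).add (hv.const_mul b)).add
    (hH.const_mul c)

theorem hasExpGrowth_besselNEntire (a b c : ℂ) (hν : ∀ n : ℕ, ν ≠ -((n : ℂ) + 1)) :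
    HasExpGrowth 2⁻¹ (besselNEntire a b c ν) := by
  have hρ : (0 : ℝ) < 2⁻¹ := by norm_num
  have hH := differentiable_besselEntire hν
  have hgrowth := hasExpGrowth_besselEntire hν
  have hgrowth₁ := hgrowth.twistedEuler hρ hH ν
  have hgrowth₂ := hgrowth₁.twistedEuler hρ (differentiable_twistedEuler hH ν) (ν - 1)
  exact (((HasExpGrowth.const _ a).mul hgrowth₂).add ((HasExpGrowth.const _ b).mul hgrowth₁)).add
    ((HasExpGrowth.const _ c).mul hgrowth)

theorem besselNEntire_zero_ne_zero {a b c : ℂ} (hν : ∀ n : ℕ, ν ≠ -((n : ℂ) + 1))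
    (h0 : a * ν ^ 2 + c + (b - a) * ν ≠ 0) : besselNEntire a b c ν 0 ≠ 0 := by
  have hvalue : besselEntire ν 0 = besselCoeff ν 0 := by
    rw [besselEntire, tsum_eq_single 0 fun n hn => by simp [hn]]
    simp
  have hfactor : besselNEntire a b c ν 0 = (a * ν ^ 2 + c + (b - a) * ν) * besselCoeff ν 0 := by
    simp only [besselNEntire, twistedEuler, hvalue]
    ring
  rw [hfactor]
  exact mul_ne_zero h0 (besselCoeff_ne_zero hν 0)

theorem taylorAtZero_besselNEntire (a b c : ℂ) (hν : ∀ n : ℕ, ν ≠ -((n : ℂ) + 1)) :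
    taylorAtZero (besselNEntire a b c ν) =
      C a * taylorAtZero (twistedEuler (ν - 1) (twistedEuler ν (besselEntire ν)))
        + C b * taylorAtZero (twistedEuler ν (besselEntire ν))
        + C c * taylorAtZero (besselEntire ν) := by
  have hH := differentiable_besselEntire hν
  have hv := differentiable_twistedEuler hH ν
  have hab : Differentiable ℂ fun w =>
      a * twistedEuler (ν - 1) (twistedEuler ν (besselEntire ν)) w
        + b * twistedEuler ν (besselEntire ν) w :=
    ((differentiable_twistedEuler hv (ν - 1)).const_mul a).add (hv.const_mul b)
  rw [← taylorAtZero_const_mul, ← taylorAtZero_const_mul, ← taylorAtZero_const_mul,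
    ← taylorAtZero_add (((differentiable_twistedEuler hv (ν - 1)).const_mul a).analyticAt 0)
      ((hv.const_mul b).analyticAt 0),
    ← taylorAtZero_add (hab.analyticAt 0) ((hH.const_mul c).analyticAt 0)]
  rfl

theorem coeff_taylorAtZero_besselNEntire (a b c : ℂ) (hν : ∀ n : ℕ, ν ≠ -((n : ℂ) + 1)) (n : ℕ) :
    coeff n (taylorAtZero (besselNEntire a b c ν)) =
      (a * ((ν - 1 + 2 * n) * (ν + 2 * n)) + b * (ν + 2 * n) + c) * besselCoeff ν n := by
  have hH := differentiable_besselEntire hν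
  rw [taylorAtZero_besselNEntire a b c hν, map_add, map_add, coeff_C_mul, coeff_C_mul, coeff_C_mul,
    coeff_taylorAtZero_twistedEuler (differentiable_twistedEuler hH ν),
    coeff_taylorAtZero_twistedEuler hH, taylorAtZero_besselEntire hν, coeff_mk]
  ring

theorem exists_coeff_taylorAtZero_besselNEntire_ne_zero {a b c : ℂ}
    (hν : ∀ n : ℕ, ν ≠ -((n : ℂ) + 1)) (h0 : a * ν ^ 2 + c + (b - a) * ν ≠ 0) (N : ℕ) :
    ∃ n > N, coeff n (taylorAtZero (besselNEntire a b c ν)) ≠ 0 := by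
  by_contra! h
  have hroot : ∀ n > N, a * ((ν - 1 + 2 * n) * (ν + 2 * n)) + b * (ν + 2 * n) + c = 0 :=
    fun n hn => by
      have hn0 := h n hn
      rw [coeff_taylorAtZero_besselNEntire a b c hν] at hn0
      exact (mul_eq_zero.1 hn0).resolve_right (besselCoeff_ne_zero hν n)
  have hroot₁ := hroot (N + 1) (by omega)
  have hroot₂ := hroot (N + 2) (by omega)
  have hroot₃ := hroot (N + 3) (by omega)
  push_cast at hroot₁ hroot₂ hroot₃
  have ha : a = 0 := by linear_combination (hroot₁ - 2 * hroot₂ + hroot₃) / 8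
  subst ha
  have hb : b = 0 := by linear_combination (hroot₂ - hroot₁) / 2
  subst hb
  have hc : c = 0 := by linear_combination hroot₁
  exact h0 (by rw [hc]; ring)

end Bessel

section Riccati

variable {k R : Type*} [CommRing k] [CommRing R] [Algebra k R] {D : Derivation k R R}
  {x a b c ν h v g A B E : R}

/-- With `∂ = D + ν` the hypotheses say `∂ h = v` and `∂ v = (ν ^ 2 - x) h`, hence `g = A h + B v`
and `∂ g = E h + A v`; Cramer's rule with determinant `A ^ 2 - B E` eliminates `h` and `v` from
`∂ (∂ g)`. -/
theorem secondOrder_of_besselSystem (hx : D x = 2 * x) (ha : D a = 0) (hb : D b = 0) (hc : D c = 0)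
    (hν : D ν = 0) (hh : D h = v - ν * h) (hv : D v = (ν ^ 2 - x) * h - ν * v)
    (hA : A = a * ν ^ 2 + c - a * x) (hB : B = b - a) (hE : E = B * ν ^ 2 - (a + b) * x)
    (hg : g = A * h + B * v) :
    (A ^ 2 - B * E) * (D (D g + ν * g) + ν * (D g + ν * g)) =
      D (A ^ 2 - B * E) * (D g + ν * g)
        + ((ν ^ 2 - x) * (A ^ 2 - B * E) + 4 * a * x * E - 2 * (a + b) * x * A) * g := by
  have hDA : D A = -2 * a * x := by
    simp only [hA, map_add, map_sub, D.leibniz, D.leibniz_pow, smul_eq_mul, hx, ha, hc, hν]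
    ring
  have hDB : D B = 0 := by rw [hB, map_sub, ha, hb, sub_zero]
  have hDE : D E = -2 * (a + b) * x := by
    simp only [hE, map_add, map_sub, D.leibniz, D.leibniz_pow, smul_eq_mul, hx, ha, hb, hν, hDB]
    ring
  have hfirst : D g + ν * g = E * h + A * v := by
    simp only [hg, map_add, D.leibniz, smul_eq_mul, hDA, hDB, hh, hv]
    rw [hE, hB]
    ring
  have hsecond : D (E * h + A * v) + ν * (E * h + A * v) =
      (A * (ν ^ 2 - x) - 2 * (a + b) * x) * h + (E - 2 * a * x) * v := by
    simp only [map_add, D.leibniz, smul_eq_mul, hDA, hDE, hh, hv]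
    ring
  have hdet : D (A ^ 2 - B * E) = -4 * a * x * A + 2 * (a + b) * x * B := by
    simp only [map_sub, D.leibniz, D.leibniz_pow, smul_eq_mul, hDA, hDB, hDE]
    ring
  rw [hfirst, hsecond, hdet, hg, hE, hB]
  ring

theorem riccati_of_besselSystem [IsDomain R] (hx : D x = 2 * x) (ha : D a = 0) (hb : D b = 0)
    (hc : D c = 0) (hν : D ν = 0) (hh : D h = v - ν * h) (hv : D v = (ν ^ 2 - x) * h - ν * v)
    (hA : A = a * ν ^ 2 + c - a * x) (hB : B = b - a) (hE : E = B * ν ^ 2 - (a + b) * x)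
    (hg : g = A * h + B * v) (hg0 : g ≠ 0) {S : R} (hS : D g = -(2 * S * g)) :
    (A ^ 2 - B * E) * (4 * S ^ 2 - 4 * ν * S - 2 * D S) =
      D (A ^ 2 - B * E) * (ν - 2 * S) - x * (A ^ 2 - B * E)
        + 4 * a * x * E - 2 * (a + b) * x * A := by
  have hsecond := secondOrder_of_besselSystem hx ha hb hc hν hh hv hA hB hE hg
  have htwo : D (2 : R) = 0 := D.map_natCast 2
  simp only [map_add, map_neg, D.leibniz, smul_eq_mul, hS, hν, htwo] at hsecond
  refine mul_right_cancel₀ hg0 ?_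
  linear_combination hsecond

end Riccati

section RiccatiSeries

open PowerSeries

variable {S : ℂ⟦X⟧}

theorem coeff_sq_of_coeff_zero_eq_zero (h0 : coeff 0 S = 0) (n : ℕ) :
    coeff n (S ^ 2) = ∑ m ∈ Finset.Icc 1 (n - 1), coeff m S * coeff (n - m) S := by
  rw [sq, coeff_mul, Finset.Nat.sum_antidiagonal_eq_sum_range_succ_mk]
  refine (Finset.sum_subset (fun m hm => ?_) fun m hm hm' => ?_).symm
  · simp only [Finset.mem_Icc, Finset.mem_range] at hm ⊢
    omega
  · simp only [Finset.mem_Icc, Finset.mem_range, not_and, not_le] at hm hm'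
    rcases Nat.eq_zero_or_pos m with rfl | hm1
    · simp [h0]
    · have hnm : n - m = 0 := by have := hm' hm1; omega
      simp [hnm, h0]

/-- The Riccati expression `S² - X S' - μ S`, to which the summands of the recurrences reduce. -/
noncomputable def riccatiExpr (μ : ℂ) (S : ℂ⟦X⟧) : ℂ⟦X⟧ :=
  S ^ 2 - X * derivative ℂ S - C μ * S

theorem coeff_riccatiExpr (h0 : coeff 0 S = 0) (μ : ℂ) (n : ℕ) :
    coeff n (riccatiExpr μ S) =
      ∑ m ∈ Finset.Icc 1 (n - 1), coeff m S * coeff (n - m) S - (n + μ) * coeff n S := by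
  rw [riccatiExpr, map_sub, map_sub, coeff_C_mul, coeff_sq_of_coeff_zero_eq_zero h0]
  rcases n with _ | n
  · simp [h0]
  · rw [coeff_succ_X_mul, coeff_derivative]
    push_cast
    ring

theorem two_mul_X_mul_derivative_twistedEuler_besselEntire {ν : ℂ}
    (hν : ∀ n : ℕ, ν ≠ -((n : ℂ) + 1)) :
    2 * X * derivative ℂ (taylorAtZero (twistedEuler ν (besselEntire ν))) =
      (C ν ^ 2 - X) * taylorAtZero (besselEntire ν)
        - C ν * taylorAtZero (twistedEuler ν (besselEntire ν)) := by
  have hH := differentiable_besselEntire hν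
  suffices hcoeff : taylorAtZero (twistedEuler ν (twistedEuler ν (besselEntire ν))) =
      C (ν ^ 2) * taylorAtZero (besselEntire ν) - X * taylorAtZero (besselEntire ν) by
    rw [taylorAtZero_twistedEuler (differentiable_twistedEuler hH ν), map_pow] at hcoeff
    linear_combination hcoeff
  ext n
  rw [coeff_taylorAtZero_twistedEuler (differentiable_twistedEuler hH ν),
    coeff_taylorAtZero_twistedEuler hH, map_sub, coeff_C_mul, taylorAtZero_besselEntire hν]
  rcases n with _ | n
  · rw [coeff_zero_X_mul, coeff_mk, Nat.cast_zero]
    ring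
  · rw [coeff_succ_X_mul, coeff_mk, coeff_mk]
    push_cast
    linear_combination besselCoeff_succ hν n

theorem det_besselSystem (a b c ν : ℂ) :
    (C a * C ν ^ 2 + C c - C a * X) ^ 2
        - (C b - C a) * ((C b - C a) * C ν ^ 2 - (C a + C b) * X) =
      C (coeffQ a b c ν) - C (coeffP a b c ν) * X + C (a ^ 2) * X ^ 2 := by
  have hC2 : (C 2 : ℂ⟦X⟧) = 2 := map_ofNat C 2
  simp only [coeffP, coeffQ, map_add, map_sub, map_mul, map_pow, hC2]
  ring

theorem riccati_besselNEntire {a b c ν : ℂ} (hν : ∀ n : ℕ, ν ≠ -((n : ℂ) + 1))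
    (h0 : taylorAtZero (besselNEntire a b c ν) ≠ 0)
    (hS : X * derivative ℂ (taylorAtZero (besselNEntire a b c ν)) =
      -(S * taylorAtZero (besselNEntire a b c ν))) :
    C (4 * coeffQ a b c ν) * riccatiExpr ν S
        - C (4 * coeffP a b c ν) * (X * riccatiExpr (ν - 1) S)
        + C (4 * a ^ 2) * (X * (X * riccatiExpr (ν - 2) S)) =
      C (-(2 * ν * coeffP a b c ν + coeffQ a b c ν + 2 * coeffR a b c ν)) * X
        + C (4 * ν * a ^ 2 + coeffP a b c ν - 2 * a * (a + b)) * (X * X)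
        + C (-a ^ 2) * (X * (X * X)) := by
  have hH := differentiable_besselEntire hν
  let D : Derivation ℂ ℂ⟦X⟧ ℂ⟦X⟧ := (2 * X : ℂ⟦X⟧) • derivative ℂ
  have hD : ∀ f, D f = 2 * X * derivative ℂ f := fun f => rfl
  have hDC : ∀ z, D (C z) = 0 := fun z => by rw [hD, derivative_C, mul_zero]
  have hDX : D X = 2 * X := by rw [hD, derivative_X, mul_one]
  have hv := taylorAtZero_twistedEuler hH ν
  have hDv := two_mul_X_mul_derivative_twistedEuler_besselEntire hν
  have hg := taylorAtZero_besselNEntire a b c hν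
  rw [taylorAtZero_twistedEuler (differentiable_twistedEuler hH ν)] at hg
  have hricc := riccati_of_besselSystem (S := S) hDX (hDC a) (hDC b) (hDC c) (hDC ν)
    (h := taylorAtZero (besselEntire ν)) (v := taylorAtZero (twistedEuler ν (besselEntire ν)))
    (by rw [hD]; linear_combination -hv) (by rw [hD, hDv]) rfl rfl rfl
    (by rw [hg, map_sub, map_one]; linear_combination C a * hDv) h0
    (by rw [hD]; linear_combination 2 * hS)
  have hC2 : (C 2 : ℂ⟦X⟧) = 2 := map_ofNat C 2
  have hC3 : (C 3 : ℂ⟦X⟧) = 3 := map_ofNat C 3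
  have hC4 : (C 4 : ℂ⟦X⟧) = 4 := map_ofNat C 4
  have hDdet : D (C (coeffQ a b c ν) - C (coeffP a b c ν) * X + C (a ^ 2) * X ^ 2) =
      -2 * C (coeffP a b c ν) * X + 4 * C (a ^ 2) * X ^ 2 := by
    simp only [map_add, map_sub, D.leibniz, D.leibniz_pow, smul_eq_mul, hDC, hDX]
    ring
  rw [det_besselSystem, hDdet, hD] at hricc
  simp only [riccatiExpr, coeffP, coeffQ, coeffR, map_add, map_sub, map_mul, map_pow, map_neg,
    map_one, hC2, hC3, hC4] at hricc ⊢
  linear_combination hricc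

end RiccatiSeries

section Recurrences

open PowerSeries

variable {a b c ν : ℂ}

theorem riccati_powerSumSeries {ι : Type*} {ζ : ι → ℂ} (hν : ∀ n : ℕ, ν ≠ -((n : ℂ) + 1))
    (h0 : a * ν ^ 2 + c + (b - a) * ν ≠ 0) (hζ : ListsZeros (besselNEntire a b c ν) ζ) :
    C (4 * coeffQ a b c ν) * riccatiExpr ν (powerSumSeries ζ)
        - C (4 * coeffP a b c ν) * (X * riccatiExpr (ν - 1) (powerSumSeries ζ))
        + C (4 * a ^ 2) * (X * (X * riccatiExpr (ν - 2) (powerSumSeries ζ))) =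
      C (-(2 * ν * coeffP a b c ν + coeffQ a b c ν + 2 * coeffR a b c ν)) * X
        + C (4 * ν * a ^ 2 + coeffP a b c ν - 2 * a * (a + b)) * (X * X)
        + C (-a ^ 2) * (X * (X * X)) := by
  refine riccati_besselNEntire hν (fun h => ?_) <| hζ.X_mul_derivative_taylorAtZero
    (differentiable_besselNEntire a b c hν) (besselNEntire_zero_ne_zero hν h0) (by norm_num)
    (by norm_num) (hasExpGrowth_besselNEntire a b c hν)
  obtain ⟨n, -, hn⟩ := exists_coeff_taylorAtZero_besselNEntire_ne_zero hν h0 0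
  exact hn (by rw [h, map_zero])

variable {t : ℕ → ℂ}

theorem coeff_riccatiExpr_powerSumSeries_sq (t : ℕ → ℂ) (μ : ℂ) {n : ℕ} (hn : n ≠ 0) :
    coeff n (riccatiExpr μ (powerSumSeries fun k => t k ^ 2)) =
      ∑ m ∈ Finset.Icc 1 (n - 1), rayleighSum t m * rayleighSum t (n - m)
        - (n + μ) * rayleighSum t n := by
  rw [coeff_riccatiExpr (coeff_zero_powerSumSeries _), coeff_powerSumSeries _ hn]
  congr 1
  refine Finset.sum_congr rfl fun m hm => ?_
  rw [Finset.mem_Icc] at hm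
  rw [coeff_powerSumSeries _ (by omega), coeff_powerSumSeries _ (by omega)]
  rfl

theorem coeff_zero_riccatiExpr_powerSumSeries {ι : Type*} (ζ : ι → ℂ) (μ : ℂ) :
    coeff 0 (riccatiExpr μ (powerSumSeries ζ)) = 0 := by
  simp [coeff_riccatiExpr, coeff_zero_powerSumSeries]

theorem coeff_one_riccatiExpr_powerSumSeries_sq (t : ℕ → ℂ) (μ : ℂ) :
    coeff 1 (riccatiExpr μ (powerSumSeries fun k => t k ^ 2)) = -(1 + μ) * rayleighSum t 1 := by
  rw [coeff_riccatiExpr_powerSumSeries_sq t μ one_ne_zero, show Finset.Icc 1 (1 - 1) = ∅ from rfl,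
    Finset.sum_empty]
  push_cast
  ring

theorem coeff_two_riccatiExpr_powerSumSeries_sq (t : ℕ → ℂ) (μ : ℂ) :
    coeff 2 (riccatiExpr μ (powerSumSeries fun k => t k ^ 2)) =
      rayleighSum t 1 ^ 2 - (2 + μ) * rayleighSum t 2 := by
  rw [coeff_riccatiExpr_powerSumSeries_sq t μ two_ne_zero]
  simp [← sq]

theorem coeff_three_riccatiExpr_powerSumSeries_sq (t : ℕ → ℂ) (μ : ℂ) :
    coeff 3 (riccatiExpr μ (powerSumSeries fun k => t k ^ 2)) =
      2 * rayleighSum t 1 * rayleighSum t 2 - (3 + μ) * rayleighSum t 3 := by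
  rw [coeff_riccatiExpr_powerSumSeries_sq t μ three_ne_zero,
    show Finset.Icc 1 (3 - 1) = {1, 2} from rfl, Finset.sum_pair (by decide)]
  push_cast
  ring

theorem rayleighSum_one_besselN (hν : ∀ n : ℕ, ν ≠ -((n : ℂ) + 1))
    (h0 : a * ν ^ 2 + c + (b - a) * ν ≠ 0)
    (ht : ListsZeros (besselNEntire a b c ν) fun k => t k ^ 2) (hq : coeffQ a b c ν ≠ 0) :
    rayleighSum t 1 = (2 * ν * coeffP a b c ν + coeffQ a b c ν + 2 * coeffR a b c ν) /
      (4 * coeffQ a b c ν * (ν + 1)) := by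
  have hcoeff := congrArg (coeff 1) (riccati_powerSumSeries hν h0 ht)
  simp only [LinearMap.map_add, LinearMap.map_sub, coeff_C_mul, coeff_succ_X_mul, coeff_zero_X_mul,
    coeff_one_X, coeff_zero_X, coeff_zero_riccatiExpr_powerSumSeries,
    coeff_one_riccatiExpr_powerSumSeries_sq] at hcoeff
  have hν1 : ν + 1 ≠ 0 := fun h => hν 0 (by push_cast; linear_combination h)
  rw [eq_div_iff (by simp [hq, hν1])]
  linear_combination -hcoeff

theorem rayleighSum_two_besselN (hν : ∀ n : ℕ, ν ≠ -((n : ℂ) + 1))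
    (h0 : a * ν ^ 2 + c + (b - a) * ν ≠ 0)
    (ht : ListsZeros (besselNEntire a b c ν) fun k => t k ^ 2) :
    4 * coeffQ a b c ν * (ν + 2) * rayleighSum t 2 =
      4 * coeffQ a b c ν * rayleighSum t 1 ^ 2 + 4 * ν * coeffP a b c ν * rayleighSum t 1
        - coeffP a b c ν - 4 * a ^ 2 * ν + 2 * a * (a + b) := by
  have hcoeff := congrArg (coeff 2) (riccati_powerSumSeries hν h0 ht)
  simp only [LinearMap.map_add, LinearMap.map_sub, coeff_C_mul, coeff_succ_X_mul, coeff_X,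
    OfNat.ofNat_ne_one, zero_ne_one, ↓reduceIte, coeff_zero_riccatiExpr_powerSumSeries,
    coeff_one_riccatiExpr_powerSumSeries_sq, coeff_two_riccatiExpr_powerSumSeries_sq] at hcoeff
  linear_combination -hcoeff

theorem rayleighSum_three_besselN (hν : ∀ n : ℕ, ν ≠ -((n : ℂ) + 1))
    (h0 : a * ν ^ 2 + c + (b - a) * ν ≠ 0)
    (ht : ListsZeros (besselNEntire a b c ν) fun k => t k ^ 2) :
    4 * coeffQ a b c ν * (ν + 3) * rayleighSum t 3 =
      4 * coeffP a b c ν * (ν + 1) * rayleighSum t 2 - 4 * a ^ 2 * (ν - 1) * rayleighSum t 1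
        + a ^ 2 + 8 * coeffQ a b c ν * rayleighSum t 1 * rayleighSum t 2
        - 4 * coeffP a b c ν * rayleighSum t 1 ^ 2 := by
  have hcoeff := congrArg (coeff 3) (riccati_powerSumSeries hν h0 ht)
  simp only [LinearMap.map_add, LinearMap.map_sub, coeff_C_mul, coeff_succ_X_mul, coeff_X,
    OfNat.ofNat_ne_one, ↓reduceIte, coeff_one_riccatiExpr_powerSumSeries_sq,
    coeff_two_riccatiExpr_powerSumSeries_sq, coeff_three_riccatiExpr_powerSumSeries_sq] at hcoeff
  linear_combination -hcoeff

theorem rayleighSum_add_one_besselN (hν : ∀ n : ℕ, ν ≠ -((n : ℂ) + 1))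
    (h0 : a * ν ^ 2 + c + (b - a) * ν ≠ 0)
    (ht : ListsZeros (besselNEntire a b c ν) fun k => t k ^ 2) {k : ℕ} (hk : 3 ≤ k) :
    coeffQ a b c ν * (k + ν + 1) * rayleighSum t (k + 1) =
      coeffP a b c ν * (k + ν - 1) * rayleighSum t k
        - a ^ 2 * (k + ν - 3) * rayleighSum t (k - 1)
        + coeffQ a b c ν * ∑ m ∈ Finset.Icc 1 k, rayleighSum t m * rayleighSum t (k - m + 1)
        - coeffP a b c ν * ∑ m ∈ Finset.Icc 1 (k - 1), rayleighSum t m * rayleighSum t (k - m)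
        + a ^ 2 * ∑ m ∈ Finset.Icc 1 (k - 2), rayleighSum t m * rayleighSum t (k - m - 1) := by
  have hcoeff := congrArg (coeff (k + 1)) (riccati_powerSumSeries hν h0 ht)
  obtain ⟨n, rfl⟩ := Nat.exists_eq_add_of_le' hk
  have hX : ∀ j, coeff (j + 2) (X : ℂ⟦X⟧) = 0 := fun j => by simp [coeff_X]
  simp only [LinearMap.map_add, LinearMap.map_sub, coeff_C_mul, coeff_succ_X_mul, hX,
    coeff_riccatiExpr_powerSumSeries_sq t _ (Nat.succ_ne_zero _)] at hcoeff
  have hsucc : ∀ m ∈ Finset.Icc 1 (n + 3), rayleighSum t m * rayleighSum t (n + 3 - m + 1) =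
      rayleighSum t m * rayleighSum t (n + 4 - m) := fun m hm => by
    rw [← Nat.sub_add_comm (Finset.mem_Icc.1 hm).2]
  have hpred : ∀ m ∈ Finset.Icc 1 (n + 3 - 2), rayleighSum t m * rayleighSum t (n + 3 - m - 1) =
      rayleighSum t m * rayleighSum t (n + 2 - m) := fun m _ => by
    rw [show n + 3 - m - 1 = n + 2 - m by omega]
  rw [Finset.sum_congr rfl hsucc, Finset.sum_congr rfl hpred]
  push_cast at hcoeff ⊢
  linear_combination -hcoeff / 4

theorem coeffP_zero_zero_one (ν : ℂ) : coeffP 0 0 1 ν = 0 := by simp [coeffP]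

theorem coeffQ_zero_zero_one (ν : ℂ) : coeffQ 0 0 1 ν = 1 := by simp [coeffQ]

theorem coeffR_zero_zero_one (ν : ℂ) : coeffR 0 0 1 ν = 0 := by simp [coeffR]

theorem besselN_zero_zero_one (ν z : ℂ) : besselN 0 0 1 ν z = besselJ ν z := by simp [besselN]

theorem rayleighSum_one_besselJ (hν : ∀ n : ℕ, ν ≠ -((n : ℂ) + 1))
    (ht : ListsZeros (besselNEntire 0 0 1 ν) fun k => t k ^ 2) :
    rayleighSum t 1 = 1 / (4 * (ν + 1)) := by
  simpa [coeffP_zero_zero_one, coeffQ_zero_zero_one, coeffR_zero_zero_one] using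
    rayleighSum_one_besselN hν (by simp) ht (by simp [coeffQ_zero_zero_one])

theorem rayleighSum_besselJ (hν : ∀ n : ℕ, ν ≠ -((n : ℂ) + 1))
    (ht : ListsZeros (besselNEntire 0 0 1 ν) fun k => t k ^ 2) {n : ℕ} (hn : 2 ≤ n) :
    rayleighSum t n =
      (ν + n)⁻¹ * ∑ k ∈ Finset.Icc 1 (n - 1), rayleighSum t k * rayleighSum t (n - k) := by
  have hcoeff : coeff n (riccatiExpr ν (powerSumSeries fun k => t k ^ 2)) = 0 := by
    simpa [coeffP_zero_zero_one, coeffQ_zero_zero_one, coeffR_zero_zero_one, coeff_X,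
      show n ≠ 1 by omega] using congrArg (coeff n) (riccati_powerSumSeries hν (by simp) ht)
  rw [coeff_riccatiExpr_powerSumSeries_sq t ν (by omega)] at hcoeff
  have hne : ν + n ≠ 0 := fun h => hν (n - 1) (by
    push_cast [show 1 ≤ n by omega]
    linear_combination h)
  rw [eq_inv_mul_iff_mul_eq₀ hne]
  linear_combination -hcoeff

end Recurrences

section ZeroPairs

variable {F G : ℂ → ℂ} {ν : ℂ} {f : ℂ → ℂ} {t : ℕ → ℂ}

theorem isEntireQuotient_comp_sq (hG : Differentiable ℂ G)
    (h : ∀ z ∈ Complex.slitPlane, f z = z ^ ν * G (z ^ 2)) :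
    IsEntireQuotient ν f fun z => G (z ^ 2) := by
  refine ⟨hG.comp (differentiable_id.pow 2), fun z hz => ?_⟩
  rw [h z hz, ← mul_assoc, ← Complex.cpow_add _ _ (Complex.slitPlane_ne_zero hz), neg_add_cancel,
    Complex.cpow_zero, one_mul]

theorem IsEntireQuotient.unique (hF : IsEntireQuotient ν f F) (hG : IsEntireQuotient ν f G) :
    F = G := by
  refine AnalyticOnNhd.eq_of_eventuallyEq (fun z _ => hF.1.analyticAt z)
    (fun z _ => hG.1.analyticAt z) (z₀ := 1) ?_
  filter_upwards [Complex.isOpen_slitPlane.mem_nhds Complex.one_mem_slitPlane] with z hz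
  rw [hF.2 z hz, hG.2 z hz]

theorem encard_add_encard_neg (t : ℕ → ℂ) {v : ℂ} (hv : v ≠ 0) :
    {k : ℕ | t k = v}.encard + {k : ℕ | -t k = v}.encard = {k | t k ^ 2 = v ^ 2}.encard := by
  rw [← Set.encard_union_eq]
  · congr 1
    ext k
    simp [sq_eq_sq_iff_eq_or_eq_neg, neg_eq_iff_eq_neg]
  · refine Set.disjoint_left.2 fun k (hk : t k = v) (hk' : -t k = v) => hv ?_
    rw [hk] at hk'
    exact self_eq_neg.1 hk'.symm

theorem analyticOrderAt_comp_sq (G : ℂ → ℂ) {v : ℂ} (hv : v ≠ 0) :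
    analyticOrderAt (fun z => G (z ^ 2)) v = analyticOrderAt G (v ^ 2) :=
  analyticOrderAt_comp_of_deriv_ne_zero (f := G) (g := fun z : ℂ => z ^ 2) (by fun_prop)
    (by simpa using hv)

theorem isZeroPairSequence_comp_sq_iff (h0 : G 0 ≠ 0) :
    IsZeroPairSequence (fun z => G (z ^ 2)) t ↔ ListsZeros G fun k => t k ^ 2 := by
  have horder : analyticOrderAt G 0 = 0 := analyticOrderAt_eq_zero.2 (Or.inr h0)
  have horder_sq : analyticOrderAt (fun z => G (z ^ 2)) 0 = 0 :=
    analyticOrderAt_eq_zero.2 (Or.inr (by simpa using h0))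
  have hzero : {k | t k = 0}.encard + {k | -t k = 0}.encard =
      analyticOrderAt (fun z => G (z ^ 2)) 0 ↔ {k | t k ^ 2 = 0}.encard = analyticOrderAt G 0 := by
    simp [horder, horder_sq]
  have hne_zero : ∀ v ≠ 0, ({k | t k = v}.encard + {k | -t k = v}.encard =
      analyticOrderAt (fun z => G (z ^ 2)) v ↔
        {k | t k ^ 2 = v ^ 2}.encard = analyticOrderAt G (v ^ 2)) := fun v hv => by
    rw [encard_add_encard_neg t hv, analyticOrderAt_comp_sq G hv]
  refine ⟨fun h w => ?_, fun h v => ?_⟩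
  · obtain ⟨v, rfl⟩ := IsAlgClosed.exists_pow_nat_eq w two_pos
    rcases eq_or_ne v 0 with rfl | hv
    · simpa using hzero.1 (h 0)
    · exact (hne_zero v hv).1 (h v)
  · rcases eq_or_ne v 0 with rfl | hv
    · exact hzero.2 (by simpa using h 0)
    · exact (hne_zero v hv).2 (h _)

theorem listsZeros_sigma (hG : Differentiable ℂ G) (h0 : G 0 ≠ 0) :
    ListsZeros G fun i : (Σ w : {w // G w = 0}, Fin (analyticOrderNatAt G w)) => (i.1 : ℂ) := by
  have htop : ∀ w, analyticOrderAt G w ≠ ⊤ := fun w hw => by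
    rw [AnalyticOnNhd.analyticOrderAt_eq_top_iff_eq_zero w fun z => hG.analyticAt z] at hw
    exact h0 (congrFun hw 0)
  intro w
  by_cases hw : G w = 0
  · have hfiber : {i : (Σ w : {w // G w = 0}, Fin (analyticOrderNatAt G w)) | (i.1 : ℂ) = w} =
        Set.range (Sigma.mk ⟨w, hw⟩) := by
      ext ⟨⟨x, hx⟩, i⟩
      constructor
      · rintro rfl
        exact ⟨i, rfl⟩
      · rintro ⟨j, hj⟩
        exact (congrArg (fun i => (i.1 : ℂ)) hj).symm
    rw [hfiber, ← Set.image_univ, sigma_mk_injective.encard_image, Set.encard_univ,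
      ENat.card_eq_coe_fintype_card, Fintype.card_fin]
    exact Nat.cast_analyticOrderNatAt (htop w)
  · rw [analyticOrderAt_eq_zero.2 (Or.inr hw), Set.encard_eq_zero, Set.eq_empty_iff_forall_notMem]
    rintro ⟨⟨x, hx⟩, i⟩ rfl
    exact hw hx

theorem ListsZeros.comp_equiv {ι κ : Type*} {ζ : ι → ℂ} (hζ : ListsZeros G ζ) (e : κ ≃ ι) :
    ListsZeros G (ζ ∘ e) := fun w => by
  rw [← hζ w, ← Set.encard_preimage_of_injective_subset_range e.injective
    (by simp [e.surjective.range_eq])]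
  rfl

theorem exists_listsZeros_nat {ρ : ℝ} (hG : Differentiable ℂ G) (h0 : G 0 ≠ 0) (hρ0 : 0 < ρ)
    (hρ : ρ < 1) (hgrowth : HasExpGrowth ρ G) (hpoly : ∀ P : Polynomial ℂ, ∃ w, G w ≠ P.eval w) :
    ∃ ζ : ℕ → ℂ, ListsZeros G ζ := by
  have hζ := listsZeros_sigma hG h0
  set ι := (Σ w : {w // G w = 0}, Fin (analyticOrderNatAt G w))
  have hinfinite : Infinite ι := not_finite_iff_infinite.1 fun _ => by
    obtain ⟨P, hP⟩ := hζ.exists_polynomial_of_finite hG h0 hρ0 hρ hgrowth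
    obtain ⟨w, hw⟩ := hpoly P
    exact hw (hP w)
  have hcountable : Countable ι := Set.countable_univ_iff.1 <|
    (Set.countable_iUnion fun N : ℕ =>
      (hζ.finite_setOf_norm_le hG h0 hρ0.le hgrowth N.cast_nonneg).countable).mono fun i _ =>
        Set.mem_iUnion.2 (exists_nat_ge ‖(i.1 : ℂ)‖)
  obtain ⟨_⟩ := nonempty_denumerable ι
  exact ⟨_, hζ.comp_equiv (Denumerable.eqv ι).symm⟩

theorem exists_isZeroPairSequence_comp_sq {ζ : ℕ → ℂ} (h0 : G 0 ≠ 0) (hζ : ListsZeros G ζ) :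
    ∃ t, IsZeroPairSequence (fun z => G (z ^ 2)) t := by
  choose t ht using fun k => IsAlgClosed.exists_pow_nat_eq (ζ k) two_pos
  exact ⟨t, (isZeroPairSequence_comp_sq_iff h0).2 (by simpa only [ht] using hζ)⟩

end ZeroPairs

section BesselZeros

variable {a b c ν : ℂ} {F : ℂ → ℂ}

theorem isEntireQuotient_besselN_iff (hν : ∀ n : ℕ, ν ≠ -((n : ℂ) + 1)) :
    IsEntireQuotient ν (besselN a b c ν) F ↔ F = fun z => besselNEntire a b c ν (z ^ 2) := by
  have hG := isEntireQuotient_comp_sq (differentiable_besselNEntire a b c hν) fun z hz =>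
    besselN_eq_cpow_mul a b c hν hz
  exact ⟨fun hF => hF.unique hG, fun hF => hF ▸ hG⟩

theorem exists_besselNEntire_ne_eval (hν : ∀ n : ℕ, ν ≠ -((n : ℂ) + 1))
    (h0 : a * ν ^ 2 + c + (b - a) * ν ≠ 0) (P : Polynomial ℂ) :
    ∃ w, besselNEntire a b c ν w ≠ P.eval w := by
  by_contra! h
  obtain ⟨n, hn, hne⟩ := exists_coeff_taylorAtZero_besselNEntire_ne_zero hν h0 P.natDegree
  rw [funext h, taylorAtZero_eval, Polynomial.coeff_coe] at hne
  exact hne (P.coeff_eq_zero_of_natDegree_lt hn)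

theorem exists_isZeroPairSequence_besselNEntire (hν : ∀ n : ℕ, ν ≠ -((n : ℂ) + 1))
    (h0 : a * ν ^ 2 + c + (b - a) * ν ≠ 0) :
    ∃ t, IsZeroPairSequence (fun z => besselNEntire a b c ν (z ^ 2)) t := by
  have hG0 := besselNEntire_zero_ne_zero hν h0
  obtain ⟨ζ, hζ⟩ := exists_listsZeros_nat (differentiable_besselNEntire a b c hν) hG0 (by norm_num)
    (by norm_num) (hasExpGrowth_besselNEntire a b c hν) (exists_besselNEntire_ne_eval hν h0)
  exact exists_isZeroPairSequence_comp_sq hG0 hζ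

theorem summable_norm_inv_of_listsZeros_besselNEntire {ι : Type*} {ζ : ι → ℂ}
    (hν : ∀ n : ℕ, ν ≠ -((n : ℂ) + 1)) (h0 : a * ν ^ 2 + c + (b - a) * ν ≠ 0)
    (hζ : ListsZeros (besselNEntire a b c ν) ζ) {n : ℕ} (hn : 1 ≤ n) :
    Summable fun i => ‖(ζ i ^ n)⁻¹‖ := by
  have hn' : (1 : ℝ) ≤ n := mod_cast hn
  exact hζ.summable_norm_inv_pow (differentiable_besselNEntire a b c hν)
    (besselNEntire_zero_ne_zero hν h0) (by norm_num) (hasExpGrowth_besselNEntire a b c hν)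
    (lt_of_lt_of_le (by norm_num) hn')

end BesselZeros

theorem mainTheorem2 (a b c ν p q r : ℂ)
    (hν : ∀ n : ℕ, ν ≠ -((n : ℂ) + 1))
    (h0 : a * ν ^ 2 + c + (b - a) * ν ≠ 0)
    (hp : p = coeffP a b c ν) (hq : q = coeffQ a b c ν) (hr : r = coeffR a b c ν) :
    (∃ F : ℂ → ℂ, IsEntireQuotient ν (besselN a b c ν) F) ∧
    ∀ F : ℂ → ℂ, IsEntireQuotient ν (besselN a b c ν) F →
      (∀ z : ℂ, F (-z) = F z) ∧
      (∃ t : ℕ → ℂ, IsZeroPairSequence F t) ∧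
      ∀ (t : ℕ → ℂ) (τ : ℕ → ℂ), IsZeroPairSequence F t → τ = rayleighSum t →
        (∀ k : ℕ, t k ≠ 0) ∧
        (∀ n : ℕ, 1 ≤ n → Summable fun k : ℕ => ‖((t k ^ 2) ^ n)⁻¹‖) ∧
        (q ≠ 0 → τ 1 = (2 * ν * p + q + 2 * r) / (4 * q * (ν + 1))) ∧
        4 * q * (ν + 2) * τ 2 =
          4 * q * τ 1 ^ 2 + 4 * ν * p * τ 1 - p - 4 * a ^ 2 * ν + 2 * a * (a + b) ∧
        4 * q * (ν + 3) * τ 3 =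
          4 * p * (ν + 1) * τ 2 - 4 * a ^ 2 * (ν - 1) * τ 1 + a ^ 2
            + 8 * q * τ 1 * τ 2 - 4 * p * τ 1 ^ 2 ∧
        (∀ k : ℕ, 3 ≤ k →
          q * (k + ν + 1) * τ (k + 1) =
            p * (k + ν - 1) * τ k - a ^ 2 * (k + ν - 3) * τ (k - 1)
              + q * ∑ m ∈ Finset.Icc 1 k, τ m * τ (k - m + 1)
              - p * ∑ m ∈ Finset.Icc 1 (k - 1), τ m * τ (k - m)
              + a ^ 2 * ∑ m ∈ Finset.Icc 1 (k - 2), τ m * τ (k - m - 1)) ∧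
        (a = 0 → b = 0 → c = 1 →
          p = 0 ∧ q = 1 ∧ r = 0 ∧ (∀ z : ℂ, besselN a b c ν z = besselJ ν z) ∧
          τ 1 = 1 / (4 * (ν + 1)) ∧
          ∀ n : ℕ, 2 ≤ n →
            τ n = (ν + n)⁻¹ * ∑ k ∈ Finset.Icc 1 (n - 1), τ k * τ (n - k)) := by
  have hG0 := besselNEntire_zero_ne_zero hν h0
  refine ⟨⟨_, (isEntireQuotient_besselN_iff hν).2 rfl⟩, fun F hF => ?_⟩
  obtain rfl := (isEntireQuotient_besselN_iff hν).1 hF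
  refine ⟨fun z => by simp only [neg_sq], exists_isZeroPairSequence_besselNEntire hν h0, ?_⟩
  rintro t τ ht rfl
  have hζ := (isZeroPairSequence_comp_sq_iff hG0).1 ht
  subst hp hq hr
  refine ⟨fun k hk => hζ.ne_zero hG0 k (by simp [hk]),
    fun n hn => summable_norm_inv_of_listsZeros_besselNEntire hν h0 hζ hn,
    rayleighSum_one_besselN hν h0 hζ, rayleighSum_two_besselN hν h0 hζ,
    rayleighSum_three_besselN hν h0 hζ, fun k hk => rayleighSum_add_one_besselN hν h0 hζ hk, ?_⟩
  rintro rfl rfl rfl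
  exact ⟨coeffP_zero_zero_one ν, coeffQ_zero_zero_one ν, coeffR_zero_zero_one ν,
    besselN_zero_zero_one ν, rayleighSum_one_besselJ hν hζ,
    fun n hn => rayleighSum_besselJ hν hζ hn⟩
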